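/- Let $p\in\{2,3\}$ and let $G$ be a finite non-abelian $p$-group. Suppose that $G$ is a Camina group, i.e. its derived subgroup $G'$ satisfies $G'\neq G$ and, for every $g\in G\setminus G'$, the coset $gG'$ is a conjugacy class of $G$. Then $G$ has the cut-property: every central unit of the integral group ring $\mathbb{Z}[G]$ is trivial, i.e. $\mathcal{Z}(\mathcal{U}(\mathbb{Z}[G]))=\{\pm g : g\in\mathcal{Z}(G)\}$, where $\mathcal{U}(\mathbb{Z}[G])$ is the group of units of $\mathbb{Z}[G]$ and $\mathcal{Z}(\cdot)$ denotes the centre of a group. -/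

import Mathlib

open scoped Pointwise

/-- A Camina group: `G' ≠ G`, and for every `g ∉ G'` the coset `gG'` is a conjugacy class
(necessarily the class of `g`, since `g ∈ gG'`). -/
def IsCaminaGroup (G : Type*) [Group G] : Prop :=
  commutator G ≠ ⊤ ∧
    ∀ g : G, g ∉ commutator G → g • (commutator G : Set G) = conjugatesOf g

/-- The cut-property: every element of the centre of the unit group of the integral group
ring `ℤ[G]` is trivial, that is, equal to `g` or `-g` for some `g` in the centre of `G`. -/
def HasCutProperty (G : Type*) [Group G] : Prop :=
  ∀ u ∈ Subgroup.center (MonoidAlgebra ℤ G)ˣ, ∃ g ∈ Subgroup.center G,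
    (u : MonoidAlgebra ℤ G) = MonoidAlgebra.of ℤ G g ∨
      (u : MonoidAlgebra ℤ G) = -MonoidAlgebra.of ℤ G g

/-! Arithmetic half (`hasCutProperty_of_isConj_pow`). Suppose that each power map with exponent
prime to |G| fixes every conjugacy class or inverts every one. On an irreducible representation over
an algebraic closure of ℚ, a central unit u and its image u* under g ↦ g⁻¹ act by scalars c and c'.
A field automorphism acts on character values through a power map, so it fixes c and c' or exchanges
them. Hence cc' is a rational algebraic integer, as is its inverse, and cc' = ±1. By semisimplicity
(uu*)² = 1, and comparing coefficients at 1 leaves a single nonzero coefficient ±1 in u.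

Group half. Since p ≤ 3, an exponent prime to p is ±1 mod p, so it is enough that G/G' and G' have
exponent p: outside G' the class of g absorbs powers of g^p, and inside G' they are trivial. If some
x^p lay outside G', every element of G' would be a commutator with x^p, hence a p-th power modulo
[G', G] of an element of G'; iterating gives G' = [G', G], so G' = 1.

For the exponent of G' the class is bounded by 2 when p = 2 and by 3 when p = 3. Let V = G/G' and W
= G'/[G', G] over the field with p elements; the Camina condition makes each bracket [x, ·] : V → W
with x ≠ 0 surjective. The basic inequality 2 dim W ≤ dim V comes from a Gauss sum for p = 2, and
for p = 3 from a Chevalley-Warning argument on the determinant of an alternating form. A nonzero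
functional on the next factor then forces dim V = 2 dim W and a rigid abelian subspace
(`IsCaminaBracket.finrank_data`). For p = 2 this contradicts the squaring relations; for p = 3 the
same analysis one step further down (`IsFourfoldBracket.eq_zero`) kills the fourth term. In class 2
the exponent of G' is immediate; in class 3 it follows from the expansion of [a, y³]. -/

open scoped Pointwise
open Module
open scoped commutatorElement

set_option linter.unusedSectionVars false

/-! ### Linear algebra of brackets with surjective partial maps. -/

section CaminaBracket

variable {F V W : Type*} [Field F] [AddCommGroup V] [Module F V] [FiniteDimensional F V]
  [AddCommGroup W] [Module F W] [FiniteDimensional F W]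

/-- An alternating bilinear map `V × V → W` all of whose partial maps at nonzero vectors are
surjective, with `dim V` at least twice `dim W`. -/
structure IsCaminaBracket (br : V →ₗ[F] V →ₗ[F] W) : Prop where
  alt : ∀ x, br x x = 0
  surj : ∀ x, x ≠ 0 → Function.Surjective (br x)
  two_mul_finrank_le : 2 * finrank F W ≤ finrank F V

/-- The Jacobi identity for a triple bracket `([x, y], z) ↦ f [x, y] z` with values in `F`. -/
def IsJacobi (br : V →ₗ[F] V →ₗ[F] W) (f : W →ₗ[F] V →ₗ[F] F) : Prop :=
  ∀ x y z, f (br x y) z + f (br y z) x + f (br z x) y = 0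

/-- The form embeds V in its dual and carries A into the annihilator of A, which has dimension dim V
- dim A. -/
theorem two_mul_finrank_le_of_isotropic (b : V →ₗ[F] V →ₗ[F] F)
    (hb : ∀ x, x ≠ 0 → ∃ y, b x y ≠ 0) (A : Submodule F V) (hA : ∀ x ∈ A, ∀ y ∈ A, b x y = 0) :
    2 * finrank F A ≤ finrank F V := by
  have hinj : Function.Injective b := by
    rw [injective_iff_map_eq_zero]
    intro x hx
    by_contra h
    obtain ⟨y, hy⟩ := hb x h
    exact hy (by rw [hx]; rfl)
  have hle : A.map b ≤ A.dualAnnihilator := by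
    rintro _ ⟨x, hx, rfl⟩
    rw [Submodule.mem_dualAnnihilator]
    exact fun y hy => hA x hx y hy
  have h1 : finrank F (A.map b) ≤ finrank F A.dualAnnihilator := Submodule.finrank_mono hle
  have h2 : finrank F (A.map b) = finrank F A :=
    (Submodule.equivMapOfInjective b hinj A).finrank_eq.symm
  have h3 : finrank F A + finrank F A.dualAnnihilator = finrank F V :=
    Subspace.finrank_add_finrank_dualAnnihilator_eq A
  omega

namespace IsCaminaBracket

variable {br : V →ₗ[F] V →ₗ[F] W}

theorem neg_swap (h : IsCaminaBracket br) (x y : V) : br x y = -br y x := by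
  have := h.alt (x + y)
  simp only [map_add, LinearMap.add_apply, h.alt, zero_add, add_zero] at this
  exact eq_neg_of_add_eq_zero_right this

theorem two_mul_finrank_le_of_functional (h : IsCaminaBracket br) (l : W →ₗ[F] F) (hl : l ≠ 0)
    (A : Submodule F V) (hA : ∀ x ∈ A, ∀ y ∈ A, l (br x y) = 0) :
    2 * finrank F A ≤ finrank F V := by
  refine two_mul_finrank_le_of_isotropic (br.compr₂ l) (fun x hx => ?_) A hA
  by_contra! hc
  apply hl
  ext w
  obtain ⟨y, rfl⟩ := h.surj x hx w
  exact hc y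

variable {f : W →ₗ[F] V →ₗ[F] F}

/-- Two of the three Jacobi terms end in a or a', which `f` kills. -/
theorem jacobi_apply_bracket_eq_zero (hj : IsJacobi br f) {a a' : V}
    (ha : a ∈ LinearMap.ker f.flip) (ha' : a' ∈ LinearMap.ker f.flip) : f (br a a') = 0 := by
  ext z
  have := hj a a' z
  have e1 : f (br a' z) a = 0 := LinearMap.congr_fun (LinearMap.mem_ker.1 ha) _
  have e2 : f (br z a) a' = 0 := LinearMap.congr_fun (LinearMap.mem_ker.1 ha') _
  rw [e1, e2, add_zero, add_zero] at this
  simpa using this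

/-- The subspace A = `ker f.flip` is isotropic for a nondegenerate form `f.flip y ∘ br`, so 2 dim A
≤ dim V. But dim A ≥ dim V - dim W ≥ dim V / 2, so equality holds throughout. -/
theorem finrank_data (h : IsCaminaBracket br) (hj : IsJacobi br f) (hf : f ≠ 0) :
    finrank F V = 2 * finrank F W ∧ finrank F (LinearMap.ker f.flip) = finrank F W := by
  obtain ⟨y, hy⟩ : ∃ y, f.flip y ≠ 0 := by
    by_contra! hc
    apply hf
    ext w y
    exact LinearMap.congr_fun (hc y) w
  have h1 := h.two_mul_finrank_le_of_functional (f.flip y) hy (LinearMap.ker f.flip)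
    (fun a ha a' ha' => by
      rw [LinearMap.flip_apply, jacobi_apply_bracket_eq_zero hj ha ha']; rfl)
  have h2 := LinearMap.finrank_range_add_finrank_ker f.flip
  have h3 := Submodule.finrank_le (LinearMap.range f.flip)
  rw [Subspace.dual_finrank_eq] at h3
  have h4 := h.two_mul_finrank_le
  omega

theorem finrank_pos (hf : f ≠ 0) : 0 < finrank F W := by
  rw [Module.finrank_pos_iff_exists_ne_zero]
  by_contra! hc
  apply hf
  ext w y
  simp [hc w]

theorem flip_surjective (h : IsCaminaBracket br) (hj : IsJacobi br f) (hf : f ≠ 0) :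
    Function.Surjective f.flip := by
  rw [← LinearMap.range_eq_top]
  apply Submodule.eq_top_of_finrank_eq
  have h2 := LinearMap.finrank_range_add_finrank_ker f.flip
  have := h.finrank_data hj hf
  rw [Subspace.dual_finrank_eq]
  omega

theorem injective_of_ne_zero (h : IsCaminaBracket br) (hj : IsJacobi br f) (hf : f ≠ 0) :
    Function.Injective f := by
  rw [injective_iff_map_eq_zero]
  intro w hw
  rw [← Module.forall_dual_apply_eq_zero_iff F]
  intro l
  obtain ⟨x, rfl⟩ := h.flip_surjective hj hf l
  rw [LinearMap.flip_apply, hw]; rfl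

theorem bracket_eq_zero (h : IsCaminaBracket br) (hj : IsJacobi br f) (hf : f ≠ 0) {a a' : V}
    (ha : a ∈ LinearMap.ker f.flip) (ha' : a' ∈ LinearMap.ker f.flip) : br a a' = 0 :=
  h.injective_of_ne_zero hj hf (by rw [jacobi_apply_bracket_eq_zero hj ha ha', map_zero])

theorem finrank_ker_add (h : IsCaminaBracket br) {x : V} (hx : x ≠ 0) :
    finrank F (LinearMap.ker (br x)) + finrank F W = finrank F V := by
  have h2 := LinearMap.finrank_range_add_finrank_ker (br x)
  rw [LinearMap.range_eq_top.2 (h.surj x hx), finrank_top] at h2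
  omega

/-- A is abelian for the bracket, so it lies in the centralizer of a, and both have dimension dim W.
-/
theorem ker_eq (h : IsCaminaBracket br) (hj : IsJacobi br f) (hf : f ≠ 0) {a : V}
    (ha : a ∈ LinearMap.ker f.flip) (ha0 : a ≠ 0) :
    LinearMap.ker (br a) = LinearMap.ker f.flip := by
  symm
  apply Submodule.eq_of_le_of_finrank_eq
  · exact fun x hx => h.bracket_eq_zero hj hf ha hx
  · have := h.finrank_data hj hf
    have := h.finrank_ker_add ha0
    omega

end IsCaminaBracket

end CaminaBracket

/-! ### The form [w, x, v] in weight four. -/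

section FourfoldBracket

variable {F V W : Type*} [Field F] [AddCommGroup V] [Module F V] [FiniteDimensional F V]
  [AddCommGroup W] [Module F W] [FiniteDimensional F W]

/-- The vectors `v` with `Φ v w x = 0` for all `w`. -/
def cokernelAt (Φ : V →ₗ[F] W →ₗ[F] V →ₗ[F] F) (x : V) : Submodule F V :=
  LinearMap.ker ((LinearMap.lflip.toLinearMap ∘ₗ Φ).flip x)

theorem mem_cokernelAt {Φ : V →ₗ[F] W →ₗ[F] V →ₗ[F] F} {x v : V} :
    v ∈ cokernelAt Φ x ↔ ∀ w, Φ v w x = 0 := by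
  rw [cokernelAt, LinearMap.mem_ker, LinearMap.ext_iff]
  rfl

theorem ker_le_cokernelAt (Φ : V →ₗ[F] W →ₗ[F] V →ₗ[F] F) (x : V) :
    LinearMap.ker Φ ≤ cokernelAt Φ x := by
  intro v hv
  rw [mem_cokernelAt, LinearMap.mem_ker.1 hv]
  intro w; rfl

theorem finrank_le_finrank_cokernelAt_add (Φ : V →ₗ[F] W →ₗ[F] V →ₗ[F] F) (x : V) :
    finrank F V ≤ finrank F (cokernelAt Φ x) + finrank F W := by
  have h2 := LinearMap.finrank_range_add_finrank_ker ((LinearMap.lflip.toLinearMap ∘ₗ Φ).flip x)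
  have h3 := Submodule.finrank_le
    (LinearMap.range ((LinearMap.lflip.toLinearMap ∘ₗ Φ).flip x))
  rw [Subspace.dual_finrank_eq] at h3
  rw [cokernelAt]
  omega

/-- The properties of the form `Φ v w x = [w, x, v]` on the lower central factors of a Camina
`p`-group of class four, with `β w w' = [w, w']`. -/
structure IsFourfoldBracket (br : V →ₗ[F] V →ₗ[F] W) (Φ : V →ₗ[F] W →ₗ[F] V →ₗ[F] F)
    (β : W →ₗ[F] W →ₗ[F] F) : Prop where
  jacobi : ∀ v, IsJacobi br (Φ v)
  alt : ∀ w, β w w = 0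
  swap : ∀ w x v, Φ v w x - Φ x w v = β w (br x v)
  bound : ∀ x v, x ≠ 0 → v ∈ cokernelAt Φ x → v ∉ LinearMap.ker Φ →
    2 * finrank F (cokernelAt Φ x) ≤ finrank F W + 2 * finrank F (LinearMap.ker Φ)

namespace IsFourfoldBracket

variable {br : V →ₗ[F] V →ₗ[F] W} {Φ : V →ₗ[F] W →ₗ[F] V →ₗ[F] F} {β : W →ₗ[F] W →ₗ[F] F}

theorem alt_swap (h : IsFourfoldBracket br Φ β) (w w' : W) : β w w' = -β w' w := by
  have := h.alt (w + w')
  simp only [map_add, LinearMap.add_apply, h.alt, zero_add, add_zero] at this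
  exact eq_neg_of_add_eq_zero_right this

theorem apply_of_mem_ker (h : IsFourfoldBracket br Φ β) {y : V} (hy : y ∈ LinearMap.ker Φ)
    (w : W) (v : V) : Φ v w y = β w (br y v) := by
  have := h.swap w y v
  rw [LinearMap.mem_ker.1 hy] at this
  simpa using this

/-- Jacobi with x, y ∈ B = `ker Φ` expresses Φ through β alone. The right side is symmetric in v and
v', which is what `bracket_mem_ker` exploits; on the diagonal it becomes twice one value of β. -/
theorem apply_bracket (h : IsFourfoldBracket br Φ β) (hb : IsCaminaBracket br) {x y : V}
    (hx : x ∈ LinearMap.ker Φ) (hy : y ∈ LinearMap.ker Φ) (v v' : V) :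
    Φ v' (br x y) v = β (br x v) (br y v') - β (br y v) (br x v') := by
  have := h.jacobi v' x y v
  rw [h.apply_of_mem_ker hx, h.apply_of_mem_ker hy, hb.neg_swap v x, map_neg,
    LinearMap.neg_apply] at this
  linear_combination this

theorem apply_bracket_self (h : IsFourfoldBracket br Φ β) (hb : IsCaminaBracket br) {x y : V}
    (hx : x ∈ LinearMap.ker Φ) (hy : y ∈ LinearMap.ker Φ) (v : V) :
    Φ v (br x y) v = 2 * β (br x v) (br y v) := by
  rw [h.apply_bracket hb hx hy, h.alt_swap (br y v)]
  ring

/-- By `swap`, the value of β at [x, y] and [v, v'] is the antisymmetric part in v, v' of an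
expression that `apply_bracket` shows to be symmetric. -/
theorem bracket_mem_ker (h : IsFourfoldBracket br Φ β) (hb : IsCaminaBracket br)
    (hV : 0 < finrank F V) {x y : V} (hx : x ∈ LinearMap.ker Φ) (hy : y ∈ LinearMap.ker Φ) :
    br x y ∈ LinearMap.ker β := by
  rw [LinearMap.mem_ker]
  obtain ⟨v, hv⟩ := Module.finrank_pos_iff_exists_ne_zero.1 hV
  ext w
  obtain ⟨v', rfl⟩ := hb.surj v hv w
  rw [← h.swap, h.apply_bracket hb hx hy, h.apply_bracket hb hx hy,
    h.alt_swap (br y v), h.alt_swap (br y v'), LinearMap.zero_apply]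
  ring

/-- Any v outside `ker Φ` gives a nonzero triple bracket `Φ v`, to which the rigidity of
`IsCaminaBracket.ker_eq` applies. -/
theorem ker_eq_of_mem (h : IsFourfoldBracket br Φ β) (hb : IsCaminaBracket br) {x v : V}
    (hx : x ≠ 0) (hv : v ∈ cokernelAt Φ x) (hv' : v ∉ LinearMap.ker Φ) :
    LinearMap.ker (br x) = LinearMap.ker (Φ v).flip := by
  refine hb.ker_eq (h.jacobi v) hv' ?_ hx
  rw [LinearMap.mem_ker]
  ext w
  exact mem_cokernelAt.1 hv w

theorem mem_cokernelAt_iff_mem_ker_flip {x v : V} :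
    v ∈ cokernelAt Φ x ↔ x ∈ LinearMap.ker (Φ v).flip := by
  rw [mem_cokernelAt, LinearMap.mem_ker, LinearMap.ext_iff]
  rfl

theorem mem_cokernelAt_iff_of_mem_ker (h : IsFourfoldBracket br Φ β) {x v : V}
    (hx : x ∈ LinearMap.ker Φ) : v ∈ cokernelAt Φ x ↔ br x v ∈ LinearMap.ker β := by
  rw [mem_cokernelAt, LinearMap.mem_ker, LinearMap.ext_iff]
  refine forall_congr' fun w => ?_
  rw [h.apply_of_mem_ker hx, h.alt_swap, neg_eq_zero]
  rfl

theorem finrank_cokernelAt_of_mem_ker (h : IsFourfoldBracket br Φ β) (hb : IsCaminaBracket br)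
    {x : V} (hx : x ∈ LinearMap.ker Φ) (hx0 : x ≠ 0) :
    finrank F (cokernelAt Φ x) + finrank F W =
      finrank F V + finrank F (LinearMap.ker β) := by
  have e : cokernelAt Φ x = LinearMap.ker (β ∘ₗ br x) := by
    ext v
    rw [h.mem_cokernelAt_iff_of_mem_ker hx]
    rfl
  have h1 := LinearMap.finrank_range_add_finrank_ker (β ∘ₗ br x)
  rw [LinearMap.range_comp_of_range_eq_top _ (LinearMap.range_eq_top.2 (hb.surj x hx0))] at h1
  have h2 := LinearMap.finrank_range_add_finrank_ker β
  rw [e]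
  omega

/-- When `β = 0` the form `Φ` vanishes. -/
theorem eq_zero_of_form_eq_zero (h : IsFourfoldBracket br Φ β) (hb : IsCaminaBracket br)
    (hβ : β = 0) : Φ = 0 := by
  by_contra hΦ
  obtain ⟨v, hv⟩ : ∃ v, Φ v ≠ 0 := by
    by_contra! hc
    exact hΦ (LinearMap.ext hc)
  obtain ⟨hN, hA⟩ := hb.finrank_data (h.jacobi v) hv
  have hn : 0 < finrank F W := IsCaminaBracket.finrank_pos (V := V) hv
  have hsymm : ∀ w x v, Φ v w x = Φ x w v := by
    intro w x v
    have := h.swap w x v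
    rw [hβ] at this
    exact sub_eq_zero.1 (by simpa using this)
  -- With β = 0 the form is symmetric in its outer arguments, so the two kinds of kernel agree.
  have hker : ∀ v, cokernelAt Φ v = LinearMap.ker (Φ v).flip := by
    intro v
    ext x
    rw [← mem_cokernelAt_iff_mem_ker_flip, mem_cokernelAt, mem_cokernelAt]
    exact forall_congr' fun w => by rw [hsymm]
  have hBA : LinearMap.ker Φ ≤ LinearMap.ker (Φ v).flip := hker v ▸ ker_le_cokernelAt Φ v
  have he := Submodule.finrank_mono hBA
  -- Put n = dim W and e = dim `ker Φ`. If x in `ker (Φ v).flip` is outside `ker Φ`, then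
  -- `cokernelAt Φ x` has dimension n, and the bound 2n ≤ n + 2e gives e > 0.
  have hBpos : 0 < finrank F (LinearMap.ker Φ) := by
    obtain ⟨⟨x, hx⟩, hx0⟩ := Module.finrank_pos_iff_exists_ne_zero.1 (hA ▸ hn)
    have hx0' : x ≠ 0 := fun e => hx0 (Subtype.ext e)
    by_cases hxB : x ∈ LinearMap.ker Φ
    · exact Module.finrank_pos_iff_exists_ne_zero.2 ⟨⟨x, hxB⟩,
          fun e => hx0' (congrArg Subtype.val e)⟩
    · have h1 := h.bound x v hx0' (mem_cokernelAt_iff_mem_ker_flip.2 hx) hv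
      have h2 := (hb.finrank_data (h.jacobi x) hxB).2
      rw [hker] at h1
      omega
  -- For nonzero x in `ker Φ` symmetry gives `cokernelAt Φ x` the full dimension 2n, and 4n ≤ n + 2e
  -- contradicts e ≤ n.
  obtain ⟨⟨x, hx⟩, hx0⟩ := Module.finrank_pos_iff_exists_ne_zero.1 hBpos
  have hx0' : x ≠ 0 := fun e => hx0 (Subtype.ext e)
  have h3 : v ∈ cokernelAt Φ x := mem_cokernelAt_iff_mem_ker_flip.2 (hBA hx)
  have h1 := h.bound x v hx0' h3 hv
  have h2 := finrank_le_finrank_cokernelAt_add Φ x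
  have h4 := h.finrank_cokernelAt_of_mem_ker hb hx hx0'
  rw [hβ, LinearMap.ker_zero, finrank_top] at h4
  omega

end IsFourfoldBracket

end FourfoldBracket

/-! ### Isotropy and counting tools for the fourfold form. -/

section FourfoldBracket

variable {F V W : Type*} [Field F] [AddCommGroup V] [Module F V] [FiniteDimensional F V]
  [AddCommGroup W] [Module F W] [FiniteDimensional F W]

theorem finrank_map_add_finrank_inf_ker (g : V →ₗ[F] W) (B : Submodule F V) :
    finrank F (B.map g) + finrank F (B ⊓ LinearMap.ker g : Submodule F V) = finrank F B := by
  have h1 := LinearMap.finrank_range_add_finrank_ker (g.domRestrict B)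
  have h2 : LinearMap.range (g.domRestrict B) = B.map g := LinearMap.range_domRestrict B g
  have h3 : (LinearMap.ker (g.domRestrict B)).map B.subtype = B ⊓ LinearMap.ker g := by
    rw [LinearMap.ker_domRestrict, Submodule.map_comap_subtype]
  rw [← h3, Submodule.finrank_map_subtype_eq, ← h2, h1]

namespace IsFourfoldBracket

variable {br : V →ₗ[F] V →ₗ[F] W} {Φ : V →ₗ[F] W →ₗ[F] V →ₗ[F] F} {β : W →ₗ[F] W →ₗ[F] F}

theorem finrank_ker_le (h : IsFourfoldBracket br Φ β) (hb : IsCaminaBracket br)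
    (hV : 0 < finrank F V) (hβ : β ≠ 0) :
    2 * finrank F (LinearMap.ker Φ) ≤ finrank F V := by
  obtain ⟨w, hw⟩ : ∃ w, β w ≠ 0 := by
    by_contra! hc
    exact hβ (LinearMap.ext hc)
  refine hb.two_mul_finrank_le_of_functional (β w) hw _ fun x hx y hy => ?_
  rw [h.alt_swap, LinearMap.mem_ker.1 (h.bracket_mem_ker hb hV hx hy)]
  simp

theorem isotropic_of_apply_eq_zero (h : IsFourfoldBracket br Φ β) (hb : IsCaminaBracket br)
    (h2 : (2 : F) ≠ 0) {x y v : V} (hx : x ∈ LinearMap.ker Φ) (hy : y ∈ LinearMap.ker Φ)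
    (hv : Φ v (br x y) v = 0) : β (br x v) (br y v) = 0 := by
  rw [h.apply_bracket_self hb hx hy] at hv
  exact (mul_eq_zero.1 hv).resolve_left h2

theorem inf_ker_eq (h : IsFourfoldBracket br Φ β) (v : V) :
    LinearMap.ker Φ ⊓ LinearMap.ker (β ∘ₗ br.flip v) =
      LinearMap.ker Φ ⊓ LinearMap.ker (Φ v).flip := by
  ext x
  simp only [Submodule.mem_inf]
  refine and_congr_right fun hx => ?_
  rw [← mem_cokernelAt_iff_mem_ker_flip, h.mem_cokernelAt_iff_of_mem_ker hx]
  rfl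

/-- The dimension hypothesis says that b ↦ β([b, v], ·) maps `ker Φ` onto the whole range of β, so
isotropy of the brackets [b, v] spreads to all of W. -/
theorem form_eq_zero_of_isotropic (h : IsFourfoldBracket br Φ β) {v : V}
    (hiso : ∀ x ∈ LinearMap.ker Φ, ∀ y ∈ LinearMap.ker Φ, β (br x v) (br y v) = 0)
    (hdim : finrank F (LinearMap.ker Φ ⊓ LinearMap.ker (Φ v).flip : Submodule F V)
      + finrank F W = finrank F (LinearMap.ker Φ) + finrank F (LinearMap.ker β)) : β = 0 := by
  have h1 := finrank_map_add_finrank_inf_ker (β ∘ₗ br.flip v) (LinearMap.ker Φ)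
  rw [h.inf_ker_eq] at h1
  have h2 := LinearMap.finrank_range_add_finrank_ker β
  have h3 : (LinearMap.ker Φ).map (β ∘ₗ br.flip v) = LinearMap.range β := by
    apply Submodule.eq_of_le_of_finrank_eq
    · rw [Submodule.map_comp]
      exact LinearMap.map_le_range
    · omega
  have h4 : ∀ w, ∃ x ∈ LinearMap.ker Φ, β (br x v) = β w := by
    intro w
    have : β w ∈ (LinearMap.ker Φ).map (β ∘ₗ br.flip v) := h3 ▸ LinearMap.mem_range_self β w
    obtain ⟨x, hx, hxw⟩ := this
    exact ⟨x, hx, hxw⟩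
  ext w w'
  obtain ⟨x, hx, hxw⟩ := h4 w
  obtain ⟨y, hy, hyw⟩ := h4 w'
  rw [← hxw, h.alt_swap, ← hyw, hiso y hy x hx]
  simp

/-- The centralizer of x equals an abelian subspace `ker (Φ v).flip`: commuting is transitive
through such an x. -/
theorem bracket_eq_zero_of_mem_ker (h : IsFourfoldBracket br Φ β) (hb : IsCaminaBracket br)
    {x v : V} (hx : x ≠ 0) (hv : v ∈ cokernelAt Φ x) (hv' : v ∉ LinearMap.ker Φ) {a a' : V}
    (ha : br x a = 0) (ha' : br x a' = 0) : br a a' = 0 := by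
  have e := h.ker_eq_of_mem hb hx hv hv'
  exact hb.bracket_eq_zero (h.jacobi v) hv' (e ▸ LinearMap.mem_ker.2 ha)
    (e ▸ LinearMap.mem_ker.2 ha')

/-- Counts the pairs (x, v) with Φ v · x = 0 by fixing x; `natCard_pairs_right` counts the same
pairs by fixing v. The vector x = 0 contributes all of V. -/
theorem natCard_pairs_left [Finite F] (Φ : V →ₗ[F] W →ₗ[F] V →ₗ[F] F)
    (hc : ∀ x, x ≠ 0 → finrank F (cokernelAt Φ x) = finrank F W) :
    Nat.card {p : V × V // p.2 ∈ cokernelAt Φ p.1} + Nat.card F ^ finrank F W =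
      Nat.card F ^ finrank F V +
        Nat.card F ^ finrank F V * Nat.card F ^ finrank F W := by
  classical
  have := Module.finite_of_finite F (M := V)
  have := Fintype.ofFinite V
  have e : {p : V × V // p.2 ∈ cokernelAt Φ p.1} ≃ Σ x : V, cokernelAt Φ x :=
    { toFun := fun p => ⟨p.1.1, p.1.2, p.2⟩
      invFun := fun p => ⟨(p.1, p.2.1), p.2.2⟩
      left_inv := fun _ => rfl
      right_inv := fun _ => rfl }
  have h0 : cokernelAt Φ 0 = ⊤ := by
    rw [eq_top_iff]
    intro v _
    rw [mem_cokernelAt]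
    intro w
    rw [map_zero]
  have hV : Fintype.card V = Nat.card F ^ finrank F V := by
    rw [← Nat.card_eq_fintype_card, Module.natCard_eq_pow_finrank (K := F)]
  have hs : ∀ x : V, x ∈ Finset.univ.erase (0 : V) →
      Nat.card (cokernelAt Φ x) = Nat.card F ^ finrank F W := by
    intro x hx
    rw [Module.natCard_eq_pow_finrank (K := F), hc x (Finset.ne_of_mem_erase hx)]
  rw [Nat.card_congr e, Nat.card_sigma, ← Finset.add_sum_erase _ _ (Finset.mem_univ (0 : V)),
    Finset.sum_congr rfl hs, Finset.sum_const, Finset.card_erase_of_mem (Finset.mem_univ _),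
    Finset.card_univ, h0, Module.natCard_eq_pow_finrank (K := F), finrank_top, hV, smul_eq_mul,
    add_assoc, ← Nat.succ_mul, Nat.succ_eq_add_one, Nat.sub_add_cancel]
  exact Nat.one_le_pow _ _ Nat.card_pos

theorem natCard_pairs_right [Finite F] (Φ : V →ₗ[F] W →ₗ[F] V →ₗ[F] F)
    (hc : ∀ v, v ∉ LinearMap.ker Φ → finrank F (LinearMap.ker (Φ v).flip) = finrank F W) :
    Nat.card {p : V × V // p.2 ∈ cokernelAt Φ p.1} +
        Nat.card F ^ finrank F (LinearMap.ker Φ) * Nat.card F ^ finrank F W =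
      Nat.card F ^ finrank F (LinearMap.ker Φ) * Nat.card F ^ finrank F V +
        Nat.card F ^ finrank F V * Nat.card F ^ finrank F W := by
  classical
  have := Module.finite_of_finite F (M := V)
  have := Fintype.ofFinite V
  have e : {p : V × V // p.2 ∈ cokernelAt Φ p.1} ≃ Σ v : V, LinearMap.ker (Φ v).flip :=
    { toFun := fun p => ⟨p.1.2, p.1.1, mem_cokernelAt_iff_mem_ker_flip.1 p.2⟩
      invFun := fun p => ⟨(p.2.1, p.1), mem_cokernelAt_iff_mem_ker_flip.2 p.2.2⟩
      left_inv := fun _ => rfl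
      right_inv := fun _ => rfl }
  have hV : Fintype.card V = Nat.card F ^ finrank F V := by
    rw [← Nat.card_eq_fintype_card, Module.natCard_eq_pow_finrank (K := F)]
  have hs1 : ∀ v ∈ Finset.univ.filter (fun v => v ∈ LinearMap.ker Φ),
      Nat.card (LinearMap.ker (Φ v).flip) = Nat.card F ^ finrank F V := by
    intro v hv
    have : LinearMap.ker (Φ v).flip = ⊤ := by
      rw [LinearMap.mem_ker.1 (Finset.mem_filter.1 hv).2, LinearMap.ker_eq_top]
      rfl
    rw [this, Module.natCard_eq_pow_finrank (K := F), finrank_top]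
  have hs2 : ∀ v ∈ Finset.univ.filter (fun v => ¬ v ∈ LinearMap.ker Φ),
      Nat.card (LinearMap.ker (Φ v).flip) = Nat.card F ^ finrank F W := by
    intro v hv
    rw [Module.natCard_eq_pow_finrank (K := F), hc v (Finset.mem_filter.1 hv).2]
  have hB : (Finset.univ.filter (fun v => v ∈ LinearMap.ker Φ)).card =
      Nat.card F ^ finrank F (LinearMap.ker Φ) := by
    rw [← Module.natCard_eq_pow_finrank (K := F), Nat.card_eq_fintype_card, Fintype.card_subtype]
  have hsum := Finset.card_filter_add_card_filter_not (s := (Finset.univ : Finset V))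
    (fun v => v ∈ LinearMap.ker Φ)
  rw [hB, Finset.card_univ, hV] at hsum
  rw [Nat.card_congr e, Nat.card_sigma,
    ← Finset.sum_filter_add_sum_filter_not _ (fun v => v ∈ LinearMap.ker Φ),
    Finset.sum_congr rfl hs1, Finset.sum_congr rfl hs2, Finset.sum_const, Finset.sum_const, hB,
    smul_eq_mul, smul_eq_mul, add_assoc, ← add_mul, add_comm (Finset.card _), hsum]

/-- With N = dim V, n = dim W, e = dim `ker Φ` and q = |F|, comparing the two counts of pairs gives
q^N - q^n = q^e (q^N - q^n). -/
theorem ker_eq_bot_of_finrank_cokernelAt [Finite F] (h : IsFourfoldBracket br Φ β)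
    (hb : IsCaminaBracket br) (hn : 0 < finrank F W) (hN : finrank F V = 2 * finrank F W)
    (hc : ∀ x, x ≠ 0 → finrank F (cokernelAt Φ x) = finrank F W) :
    finrank F (LinearMap.ker Φ) = 0 := by
  have h1 := natCard_pairs_left Φ hc
  have h2 := natCard_pairs_right Φ (fun v hv => (hb.finrank_data (h.jacobi v) hv).2)
  have hq : 1 < Nat.card F := Finite.one_lt_card
  have hlt : Nat.card F ^ finrank F W < Nat.card F ^ finrank F V :=
    Nat.pow_lt_pow_right hq (by omega)
  by_contra he
  have h3 : 1 < Nat.card F ^ finrank F (LinearMap.ker Φ) := Nat.one_lt_pow he hq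
  nlinarith

end IsFourfoldBracket

end FourfoldBracket

/-! ### Vanishing of the fourfold form. -/

section FourfoldBracket

variable {F V W : Type*} [Field F] [AddCommGroup V] [Module F V] [FiniteDimensional F V]
  [AddCommGroup W] [Module F W] [FiniteDimensional F W]

namespace IsFourfoldBracket

variable {br : V →ₗ[F] V →ₗ[F] W} {Φ : V →ₗ[F] W →ₗ[F] V →ₗ[F] F} {β : W →ₗ[F] W →ₗ[F] F}

theorem exists_mem_ne_zero_of_finrank_pos {B : Submodule F V} (hB : 0 < finrank F B) :
    ∃ x ∈ B, x ≠ 0 := by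
  obtain ⟨⟨x, hx⟩, hx0⟩ := Module.finrank_pos_iff_exists_ne_zero.1 hB
  exact ⟨x, hx, fun e => hx0 (Subtype.ext e)⟩

theorem finrank_ker_le_add (h : IsFourfoldBracket br Φ β) (hb : IsCaminaBracket br)
    (hV : 0 < finrank F V) {x : V} (hx : x ∈ LinearMap.ker Φ) :
    finrank F (LinearMap.ker Φ) ≤ finrank F (LinearMap.ker β) +
      finrank F (LinearMap.ker Φ ⊓ LinearMap.ker (br x) : Submodule F V) := by
  have h1 := finrank_map_add_finrank_inf_ker (br x) (LinearMap.ker Φ)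
  have h2 : (LinearMap.ker Φ).map (br x) ≤ LinearMap.ker β := by
    rintro _ ⟨y, hy, rfl⟩
    exact h.bracket_mem_ker hb hV hx hy
  have := Submodule.finrank_mono h2
  omega

/-- The case in which `ker Φ` is abelian for the bracket. -/
theorem false_of_bracket_eq_zero [Finite F] (h : IsFourfoldBracket br Φ β)
    (hb : IsCaminaBracket br) (h2 : (2 : F) ≠ 0) (hn : 0 < finrank F W)
    (hN : finrank F V = 2 * finrank F W) (hρ : finrank F (LinearMap.ker β) < finrank F W)
    {x : V} (hx : x ∈ LinearMap.ker Φ) (hx0 : x ≠ 0)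
    (hd : 2 * finrank F (cokernelAt Φ x) ≤ finrank F W + 2 * finrank F (LinearMap.ker Φ))
    (hab : ∀ x ∈ LinearMap.ker Φ, ∀ y ∈ LinearMap.ker Φ, br x y = 0) : False := by
  have hcx := h.finrank_cokernelAt_of_mem_ker hb hx hx0
  obtain ⟨v, hv⟩ : ∃ v, v ∉ cokernelAt Φ x := by
    by_contra! hc
    have : cokernelAt Φ x = ⊤ := eq_top_iff.2 fun v _ => hc v
    rw [this, finrank_top] at hcx
    omega
  have hvB : v ∉ LinearMap.ker Φ := fun hm => hv (ker_le_cokernelAt Φ x hm)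
  have hiso : ∀ b ∈ LinearMap.ker Φ, ∀ y ∈ LinearMap.ker Φ, β (br b v) (br y v) = 0 := by
    intro b hb' y hy
    refine h.isotropic_of_apply_eq_zero hb h2 hb' hy ?_
    rw [hab b hb' y hy, map_zero, LinearMap.zero_apply]
  -- Otherwise the centralizer of b is `ker (Φ v).flip`. It contains x because `ker Φ` is abelian,
  -- which puts v in `cokernelAt Φ x`.
  have hinj : ∀ b ∈ LinearMap.ker Φ, br b v ∈ LinearMap.ker β → b = 0 := by
    intro b hbB hbv
    by_contra hb0
    have hvb := (h.mem_cokernelAt_iff_of_mem_ker hbB).2 hbv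
    have e := h.ker_eq_of_mem hb hb0 hvb hvB
    apply hv
    rw [mem_cokernelAt_iff_mem_ker_flip, ← e, LinearMap.mem_ker]
    exact hab b hbB x hx
  have hbot : LinearMap.ker Φ ⊓ LinearMap.ker (β ∘ₗ br.flip v) = ⊥ := by
    rw [eq_bot_iff]
    exact fun b hb' => hinj b hb'.1 hb'.2
  have hbot' : LinearMap.ker Φ ⊓ LinearMap.ker (br.flip v) = ⊥ := by
    rw [eq_bot_iff]
    refine fun b hb' => hinj b hb'.1 ?_
    have : br b v = 0 := hb'.2
    rw [this]
    exact zero_mem _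
  have e1 := finrank_map_add_finrank_inf_ker (β ∘ₗ br.flip v) (LinearMap.ker Φ)
  have e2 := finrank_map_add_finrank_inf_ker (br.flip v) (LinearMap.ker Φ)
  rw [hbot, finrank_bot, add_zero] at e1
  rw [hbot', finrank_bot, add_zero] at e2
  have e3 : (LinearMap.ker Φ).map (br.flip v) ⊓ LinearMap.ker β = ⊥ := by
    rw [eq_bot_iff]
    rintro _ ⟨⟨b, hbB, rfl⟩, hbβ⟩
    rw [hinj b hbB hbβ, map_zero]
    exact zero_mem _
  have e4 := Submodule.finrank_sup_add_finrank_inf_eq ((LinearMap.ker Φ).map (br.flip v))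
    (LinearMap.ker β)
  rw [e3, finrank_bot, add_zero, e2] at e4
  -- The image of `ker Φ` under [·, v] is β-isotropic and meets `ker β` trivially. With ρ = dim `ker
  -- β` this yields 2e + ρ ≤ n.
  have e5 : (LinearMap.ker Φ).map (β ∘ₗ br.flip v) ≤
      ((LinearMap.ker Φ).map (br.flip v) ⊔ LinearMap.ker β).dualAnnihilator := by
    rintro _ ⟨b, hbB, rfl⟩
    rw [Submodule.mem_dualAnnihilator]
    intro w hw
    obtain ⟨_, ⟨b', hb'B, rfl⟩, r, hr, rfl⟩ := Submodule.mem_sup.1 hw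
    have hr' : β (br b v) r = 0 := by
      rw [h.alt_swap, LinearMap.mem_ker.1 hr]
      simp
    rw [map_add]
    simp only [LinearMap.comp_apply, LinearMap.flip_apply, hr', hiso b hbB b' hb'B, add_zero]
  have e6 : finrank F ((LinearMap.ker Φ).map (β ∘ₗ br.flip v)) ≤
      finrank F ((LinearMap.ker Φ).map (br.flip v) ⊔ LinearMap.ker β).dualAnnihilator :=
    Submodule.finrank_mono e5
  have e7 : finrank F ((LinearMap.ker Φ).map (br.flip v) ⊔ LinearMap.ker β : Submodule F W) +
      finrank F ((LinearMap.ker Φ).map (br.flip v) ⊔ LinearMap.ker β).dualAnnihilator =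
      finrank F W := Subspace.finrank_add_finrank_dualAnnihilator_eq _
  -- Together with n + 2ρ ≤ 2e this forces ρ = 0 and 2e = n.
  have he : 2 * finrank F (LinearMap.ker Φ) = finrank F W := by omega
  have hall : ∀ x, x ≠ 0 → finrank F (cokernelAt Φ x) = finrank F W := by
    intro x hx
    have h1 := finrank_le_finrank_cokernelAt_add Φ x
    obtain ⟨v, hv, hv'⟩ : ∃ v ∈ cokernelAt Φ x, v ∉ LinearMap.ker Φ := by
      by_contra! hc
      have := Submodule.finrank_mono (show cokernelAt Φ x ≤ LinearMap.ker Φ from hc)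
      omega
    have := h.bound x v hx hv hv'
    omega
  have := h.ker_eq_bot_of_finrank_cokernelAt hb hn hN hall
  omega

/-- Write n = dim W, e = dim `ker Φ`, ρ = dim `ker β`; if Φ ≠ 0 then dim V = 2n, and `cokernelAt Φ
b` has dimension n + ρ for nonzero b in `ker Φ`. Three cases: `cokernelAt Φ x₀` lies in `ker Φ`;
`ker Φ` is abelian; or it is not, when the inequalities collapse to e = n = 2ρ. The first and third
show that β vanishes, against `eq_zero_of_form_eq_zero`; the second is excluded by counting. -/
theorem eq_zero [Finite F] (h : IsFourfoldBracket br Φ β) (hb : IsCaminaBracket br)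
    (h2 : (2 : F) ≠ 0) : Φ = 0 := by
  by_contra hΦ
  have hβ : β ≠ 0 := fun hβ => hΦ (h.eq_zero_of_form_eq_zero hb hβ)
  obtain ⟨v₀, hv₀⟩ : ∃ v, Φ v ≠ 0 := by
    by_contra! hc
    exact hΦ (LinearMap.ext hc)
  have hN := (hb.finrank_data (h.jacobi v₀) hv₀).1
  have hn : 0 < finrank F W := IsCaminaBracket.finrank_pos (V := V) hv₀
  have hV : 0 < finrank F V := by omega
  have hρ : finrank F (LinearMap.ker β) < finrank F W := by
    apply Submodule.finrank_lt
    rwa [Ne, LinearMap.ker_eq_top]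
  have he := h.finrank_ker_le hb hV hβ
  have hepos : 0 < finrank F (LinearMap.ker Φ) := by
    obtain ⟨x, hx⟩ := Module.finrank_pos_iff_exists_ne_zero.1 hV
    by_contra he0
    have h1 := finrank_le_finrank_cokernelAt_add Φ x
    obtain ⟨v, hv, hv'⟩ : ∃ v ∈ cokernelAt Φ x, v ∉ LinearMap.ker Φ := by
      by_contra! hc
      have := Submodule.finrank_mono (show cokernelAt Φ x ≤ LinearMap.ker Φ from hc)
      omega
    have := h.bound x v hx hv hv'
    omega
  obtain ⟨x₀, hx₀, hx₀0⟩ := exists_mem_ne_zero_of_finrank_pos hepos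
  have hcx := fun x hx hx0 => h.finrank_cokernelAt_of_mem_ker hb (x := x) hx hx0
  by_cases hd : ∃ v ∈ cokernelAt Φ x₀, v ∉ LinearMap.ker Φ
  swap
  · push Not at hd
    -- Here n + ρ ≤ e ≤ n, so β is nondegenerate and `ker Φ` is abelian for the bracket.
    have h1 := Submodule.finrank_mono (show cokernelAt Φ x₀ ≤ LinearMap.ker Φ from hd)
    have h3 := hcx x₀ hx₀ hx₀0
    refine hβ (h.form_eq_zero_of_isotropic (v := v₀) (fun x hx y hy => ?_) ?_)
    · refine h.isotropic_of_apply_eq_zero hb h2 hx hy ?_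
      have hk : LinearMap.ker β = ⊥ := Submodule.finrank_eq_zero.1 (by omega)
      have := h.bracket_mem_ker hb hV hx hy
      rw [hk, Submodule.mem_bot] at this
      rw [this, map_zero, LinearMap.zero_apply]
    · have hbot : LinearMap.ker Φ ⊓ LinearMap.ker (Φ v₀).flip = ⊥ := by
        rw [eq_bot_iff]
        intro b hb'
        by_contra hb0
        have h4 := mem_cokernelAt_iff_mem_ker_flip.2 hb'.2
        have h5 := hcx b hb'.1 hb0
        have h6 := Submodule.eq_of_le_of_finrank_le (ker_le_cokernelAt Φ b) (by omega)
        rw [← h6] at h4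
        exact hv₀ h4
      rw [hbot, finrank_bot]
      omega
  obtain ⟨u, hu, hu'⟩ := hd
  have hd := h.bound x₀ u hx₀0 hu hu'
  have hcx₀ := hcx x₀ hx₀ hx₀0
  by_cases hab : ∀ x ∈ LinearMap.ker Φ, ∀ y ∈ LinearMap.ker Φ, br x y = 0
  · exact h.false_of_bracket_eq_zero hb h2 hn hN hρ hx₀ hx₀0 hd hab
  push Not at hab
  obtain ⟨x, hx, y, hy, hxy⟩ := hab
  have hlt : finrank F (LinearMap.ker Φ) < finrank F (cokernelAt Φ x₀) :=
    Submodule.finrank_lt_finrank_of_lt (lt_of_le_of_ne (ker_le_cokernelAt Φ x₀)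
      fun e => hu' (e ▸ hu))
  -- All these `cokernelAt Φ b` have the same dimension, larger than e, so each supplies a v outside
  -- `ker Φ`, and centralizers are abelian.
  have hker : ∀ b ∈ LinearMap.ker Φ, b ≠ 0 → ∀ a a', br b a = 0 → br b a' = 0 → br a a' = 0 := by
    intro b hbB hb0 a a' ha ha'
    have h5 := hcx b hbB hb0
    obtain ⟨v, hv, hv'⟩ : ∃ v ∈ cokernelAt Φ b, v ∉ LinearMap.ker Φ := by
      by_contra! hc
      have := Submodule.finrank_mono (show cokernelAt Φ b ≤ LinearMap.ker Φ from hc)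
      omega
    exact h.bracket_eq_zero_of_mem_ker hb hb0 hv hv' ha ha'
  have hadd : ∀ b ∈ LinearMap.ker Φ, ∀ b' ∈ LinearMap.ker Φ, br b b' ≠ 0 →
      finrank F (LinearMap.ker Φ ⊓ LinearMap.ker (br b) : Submodule F V) +
      finrank F (LinearMap.ker Φ ⊓ LinearMap.ker (br b') : Submodule F V) ≤
        finrank F (LinearMap.ker Φ) := by
    intro b hbB b' hb'B hbb'
    have e := Submodule.finrank_sup_add_finrank_inf_eq (LinearMap.ker Φ ⊓ LinearMap.ker (br b))
      (LinearMap.ker Φ ⊓ LinearMap.ker (br b'))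
    have hbot : (LinearMap.ker Φ ⊓ LinearMap.ker (br b)) ⊓
        (LinearMap.ker Φ ⊓ LinearMap.ker (br b')) = ⊥ := by
      rw [eq_bot_iff]
      intro c hc
      by_contra hc0
      have e1 : br b c = 0 := hc.1.2
      have e2 : br b' c = 0 := hc.2.2
      exact hbb' (hker c hc.1.1 hc0 b b' (by rw [hb.neg_swap, e1, neg_zero])
        (by rw [hb.neg_swap, e2, neg_zero]))
    rw [hbot, finrank_bot, add_zero] at e
    rw [← e]
    exact Submodule.finrank_mono (sup_le inf_le_left inf_le_left)
  have hxge := h.finrank_ker_le_add hb hV hx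
  have hyge := h.finrank_ker_le_add hb hV hy
  have hxyle := hadd x hx y hy hxy
  -- Centralizers in `ker Φ` have dimension at least e - ρ, and those of x and y meet trivially, so
  -- e ≤ 2ρ. Combine with n + 2ρ ≤ 2e and e ≤ n.
  have hen : finrank F (LinearMap.ker Φ) = finrank F W := by omega
  have hρn : 2 * finrank F (LinearMap.ker β) = finrank F W := by omega
  -- The map b ↦ β([b, v₀], ·) sends the n-dimensional `ker Φ` into the range of β, of dimension n -
  -- ρ < n.
  obtain ⟨b, hb', hb0⟩ : ∃ b ∈ LinearMap.ker Φ ⊓ LinearMap.ker (Φ v₀).flip, b ≠ 0 := by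
    apply exists_mem_ne_zero_of_finrank_pos
    have h1 := finrank_map_add_finrank_inf_ker (β ∘ₗ br.flip v₀) (LinearMap.ker Φ)
    rw [h.inf_ker_eq, Submodule.map_comp] at h1
    have h3 := LinearMap.finrank_range_add_finrank_ker β
    have h4 := Submodule.finrank_mono (LinearMap.map_le_range (f := β)
      (p := (LinearMap.ker Φ).map (br.flip v₀)))
    omega
  obtain ⟨hbB, hbA⟩ := hb'
  obtain ⟨y', hy', hby'⟩ : ∃ y' ∈ LinearMap.ker Φ, br b y' ≠ 0 := by
    by_contra! hc
    exact hxy (hker b hbB hb0 x y (hc x hx) (hc y hy))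
  have h3 := h.finrank_ker_le_add hb hV hbB
  have h4 := h.finrank_ker_le_add hb hV hy'
  have h5 := hadd b hbB y' hy' hby'
  have e := h.ker_eq_of_mem hb hb0 (mem_cokernelAt_iff_mem_ker_flip.2 hbA) hv₀
  have hcb : finrank F (LinearMap.ker Φ ⊓ LinearMap.ker (br b) : Submodule F V) =
      finrank F (LinearMap.ker β) := by omega
  have himg : (LinearMap.ker Φ).map (br b) = LinearMap.ker β := by
    apply Submodule.eq_of_le_of_finrank_eq
    · rintro _ ⟨y, hy, rfl⟩
      exact h.bracket_mem_ker hb hV hbB hy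
    · have := finrank_map_add_finrank_inf_ker (br b) (LinearMap.ker Φ)
      omega
  have hbv : br b v₀ ∈ LinearMap.ker β :=
    (h.mem_cokernelAt_iff_of_mem_ker hbB).1 (mem_cokernelAt_iff_mem_ker_flip.2 hbA)
  -- Every w in `ker β` is some [b, y] with y ∈ `ker Φ`, and the diagonal formula carries the factor
  -- β([b, v₀], ·) = 0.
  have hzero : ∀ w ∈ LinearMap.ker β, Φ v₀ w v₀ = 0 := by
    intro w hw
    rw [← himg] at hw
    obtain ⟨y, hy, rfl⟩ := hw
    rw [h.apply_bracket_self hb hbB hy, LinearMap.mem_ker.1 hbv]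
    simp
  refine hβ (h.form_eq_zero_of_isotropic (v := v₀) (fun x hx y hy =>
    h.isotropic_of_apply_eq_zero hb h2 hx hy (hzero _ (h.bracket_mem_ker hb hV hx hy))) ?_)
  rw [← e]
  omega

end IsFourfoldBracket

end FourfoldBracket

/-! ### Determinants of alternating forms are squares. -/

section AlternatingDet

variable {F : Type*} [Field F]

/-- A change of basis multiplies the Gram determinant by a square. -/
theorem isSquare_det_toMatrix_of_basis {V ι κ : Type*} [AddCommGroup V] [Module F V]
    [Fintype ι] [DecidableEq ι] [Fintype κ] [DecidableEq κ] (B : LinearMap.BilinForm F V)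
    (b : Basis ι F V) (c : Basis κ F V) (h : IsSquare (LinearMap.BilinForm.toMatrix b B).det) :
    IsSquare (LinearMap.BilinForm.toMatrix c B).det := by
  let e : ι ≃ κ := Fintype.equivOfCardEq
    (by rw [← finrank_eq_card_basis b, finrank_eq_card_basis c])
  have h1 : (LinearMap.BilinForm.toMatrix (b.reindex e) B).det =
      (LinearMap.BilinForm.toMatrix b B).det := by
    rw [← Matrix.det_reindex_self e]
    congr 1
    ext i j
    simp [LinearMap.BilinForm.toMatrix_apply]
  have h2 := LinearMap.BilinForm.toMatrix_mul_basis_toMatrix (b.reindex e) c B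
  rw [← h2, Matrix.det_mul, Matrix.det_mul, Matrix.det_transpose, h1, mul_right_comm]
  exact (IsSquare.mul_self _).mul h

/-- Induction on dimension: a plane on which the form is nonzero splits off its orthogonal
complement, and its own determinant is B(b₀, b₁)². -/
theorem exists_basis_isSquare_det (n : ℕ) : ∀ (V : Type*) [AddCommGroup V] [Module F V]
    [FiniteDimensional F V] (B : LinearMap.BilinForm F V), B.IsAlt → finrank F V = n →
    ∃ (ι : Type) (_ : Fintype ι) (_ : DecidableEq ι) (b : Basis ι F V),
      IsSquare (LinearMap.BilinForm.toMatrix b B).det := by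
  induction n using Nat.strong_induction_on with
  | _ n ih =>
  intro V _ _ _ B hB hn
  by_cases h0 : B = 0
  · refine ⟨Fin (finrank F V), inferInstance, inferInstance, finBasis F V, ?_⟩
    rw [h0, map_zero]
    by_cases hz : Nonempty (Fin (finrank F V))
    · rw [Matrix.det_zero]
      exact IsSquare.zero
    · rw [not_nonempty_iff] at hz
      rw [Matrix.det_isEmpty]
      exact IsSquare.one
  obtain ⟨x, y, hxy⟩ : ∃ x y, B x y ≠ 0 := by
    by_contra! hc
    exact h0 (LinearMap.ext₂ hc)
  have hyx : B y x = -B x y := (hB.neg_eq x y).symm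
  set H : Submodule F V := Submodule.span F {x, y} with hH
  have hdisj : Disjoint H (B.orthogonal H) := by
    rw [Submodule.disjoint_def]
    intro z hz hz'
    obtain ⟨a, c, rfl⟩ := Submodule.mem_span_pair.1 hz
    have e1 := hz' x (Submodule.subset_span (by simp))
    have e2 := hz' y (Submodule.subset_span (by simp))
    simp only [map_add, map_smul, hB.self_eq_zero, smul_eq_mul, mul_zero, zero_add, add_zero, hyx,
      mul_neg, neg_eq_zero, mul_eq_zero, hxy, or_false] at e1 e2
    rw [e1, e2, zero_smul, zero_smul, add_zero]
  have hc := LinearMap.BilinForm.isCompl_orthogonal_of_restrict_nondegenerate hB.isRefl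
    (B.nondegenerate_restrict_of_disjoint_orthogonal hB.isRefl hdisj)
  have hli : LinearIndependent F ![x, y] := by
    rw [LinearIndependent.pair_iff]
    intro s t hst
    have e1 := congrArg (B x) hst
    have e2 := congrArg (B y) hst
    simp only [map_add, map_smul, hB.self_eq_zero, smul_eq_mul, mul_zero, zero_add, add_zero, hyx,
      mul_neg, neg_eq_zero, mul_eq_zero, hxy, or_false, map_zero] at e1 e2
    exact ⟨e2, e1⟩
  have hfr : finrank F H = 2 := by
    have := finrank_span_eq_card hli
    rwa [Matrix.range_cons, Matrix.range_cons, Matrix.range_empty, Set.union_empty,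
      Set.singleton_union, Fintype.card_fin] at this
  have hlt : finrank F (B.orthogonal H) < n := by
    have := Submodule.finrank_add_eq_of_isCompl hc
    omega
  obtain ⟨ι, _, _, b, hb⟩ := ih _ hlt (B.orthogonal H) (B.restrict (B.orthogonal H))
    (fun z => hB z) rfl
  let bH : Basis (Fin 2) F H := finBasisOfFinrankEq F H hfr
  refine ⟨Fin 2 ⊕ ι, inferInstance, inferInstance,
    (bH.prod b).map (Submodule.prodEquivOfIsCompl _ _ hc), ?_⟩
  have hM : LinearMap.BilinForm.toMatrix ((bH.prod b).map (Submodule.prodEquivOfIsCompl _ _ hc)) B =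
      Matrix.fromBlocks (LinearMap.BilinForm.toMatrix bH (B.restrict H)) 0 0
        (LinearMap.BilinForm.toMatrix b (B.restrict (B.orthogonal H))) := by
    ext (i | i) (j | j)
    · simp [LinearMap.BilinForm.toMatrix_apply]
    · simpa [LinearMap.BilinForm.toMatrix_apply] using (b j).2 (bH i) (bH i).2
    · have : B (bH j) (b i) = 0 := (b i).2 (bH j) (bH j).2
      simpa [LinearMap.BilinForm.toMatrix_apply] using hB.isRefl _ _ this
    · simp [LinearMap.BilinForm.toMatrix_apply]
  rw [hM, Matrix.det_fromBlocks_zero₂₁]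
  refine IsSquare.mul ?_ hb
  rw [Matrix.det_fin_two]
  simp only [LinearMap.BilinForm.toMatrix_apply, LinearMap.BilinForm.restrict_apply,
    LinearMap.domRestrict_apply,
    hB.self_eq_zero, zero_mul, zero_sub]
  rw [← hB.neg_eq (bH 0 : V) (bH 1), mul_neg, neg_neg]
  exact IsSquare.mul_self _

theorem isSquare_det_of_isAlt {V ι : Type*} [AddCommGroup V] [Module F V] [Fintype ι]
    [DecidableEq ι] (b : Basis ι F V) (B : LinearMap.BilinForm F V) (hB : B.IsAlt) :
    IsSquare (LinearMap.BilinForm.toMatrix b B).det := by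
  have := b.finiteDimensional_of_finite
  obtain ⟨κ, _, _, c, hc⟩ := exists_basis_isSquare_det (finrank F V) V B hB rfl
  exact isSquare_det_toMatrix_of_basis B c b hc

end AlternatingDet

/-! ### The dimension inequality for three elements, after Chevalley and Warning. -/

section AlternatingFamily

theorem ZMod.eq_one_of_isSquare_of_ne_zero {a : ZMod 3} (ha : IsSquare a) (h0 : a ≠ 0) : a = 1 := by
  obtain ⟨r, rfl⟩ := ha
  revert r
  decide

/-- A space of alternating forms over `ZMod 3` all of whose nonzero elements are nondegenerate has
at most half the dimension of the underlying space. -/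
theorem two_mul_finrank_le_of_alternating_family {L A : Type*} [AddCommGroup L]
    [Module (ZMod 3) L] [FiniteDimensional (ZMod 3) L] [AddCommGroup A] [Module (ZMod 3) A]
    [FiniteDimensional (ZMod 3) A] (hA : 0 < finrank (ZMod 3) A)
    (ψ : L →ₗ[ZMod 3] LinearMap.BilinForm (ZMod 3) A) (halt : ∀ l a, ψ l a a = 0)
    (hnd : ∀ l a, l ≠ 0 → a ≠ 0 → ∃ a', ψ l a a' ≠ 0) :
    2 * finrank (ZMod 3) L ≤ finrank (ZMod 3) A := by
  by_contra hlt
  push Not at hlt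
  have : Nonempty (Fin (finrank (ZMod 3) A)) := ⟨⟨0, hA⟩⟩
  let bL := finBasis (ZMod 3) L
  let bA := finBasis (ZMod 3) A
  let M : Matrix (Fin (finrank (ZMod 3) A)) (Fin (finrank (ZMod 3) A))
      (MvPolynomial (Fin (finrank (ZMod 3) L)) (ZMod 3)) :=
    Matrix.of fun i j => ∑ k, MvPolynomial.C (ψ (bL k) (bA i) (bA j)) * MvPolynomial.X k
  -- `M` is the Gram matrix of the generic form. Its determinant has degree at most dim A < 2 dim L,
  -- so its values over all points sum to zero.
  have hdeg : M.det.totalDegree ≤ finrank (ZMod 3) A := by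
    rw [Matrix.det_apply]
    refine MvPolynomial.totalDegree_finsetSum_le fun σ _ => ?_
    refine (MvPolynomial.totalDegree_smul_le _ _).trans ?_
    refine (MvPolynomial.totalDegree_finsetProd _ _).trans ?_
    refine (Finset.sum_le_card_nsmul _ _ 1 fun i _ => ?_).trans (by simp)
    change (∑ k, MvPolynomial.C (ψ (bL k) (bA (σ i)) (bA i)) * MvPolynomial.X k).totalDegree ≤ 1
    refine MvPolynomial.totalDegree_finsetSum_le fun k _ => ?_
    refine (MvPolynomial.totalDegree_mul _ _).trans ?_
    rw [MvPolynomial.totalDegree_C, MvPolynomial.totalDegree_X]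
  have hsum := MvPolynomial.sum_eval_eq_zero M.det (by
    rw [ZMod.card, Fintype.card_fin]
    omega)
  have heval : ∀ c, MvPolynomial.eval c M.det =
      (LinearMap.BilinForm.toMatrix bA (ψ (∑ k, c k • bL k))).det := by
    intro c
    rw [RingHom.map_det]
    congr 1
    ext i j
    simp [M, LinearMap.BilinForm.toMatrix_apply, mul_comm]
  -- At a nonzero point the determinant is a nonzero square in `ZMod 3`, hence 1.
  have hval : ∀ c, MvPolynomial.eval c M.det = if c = 0 then 0 else 1 := by
    intro c
    rw [heval]
    split_ifs with hc
    · simp [hc, Matrix.det_zero]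
    · apply ZMod.eq_one_of_isSquare_of_ne_zero (isSquare_det_of_isAlt _ _ (halt _))
      have hl : ∑ k, c k • bL k ≠ 0 := by
        intro h0
        apply hc
        funext k
        exact Fintype.linearIndependent_iff.1 bL.linearIndependent c h0 k
      rw [← LinearMap.BilinForm.nondegenerate_iff_det_ne_zero]
      have hrefl : (ψ (∑ k, c k • bL k)).IsRefl := LinearMap.BilinForm.IsAlt.isRefl (halt _)
      rw [LinearMap.BilinForm.Nondegenerate, hrefl.nondegenerate_iff_separatingLeft]
      intro a ha
      by_contra ha0
      obtain ⟨a', ha'⟩ := hnd _ a hl ha0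
      exact ha' (ha a')
  rw [Finset.sum_congr rfl fun c _ => hval c, Finset.sum_ite, Finset.sum_const_zero, zero_add,
    Finset.sum_const, Finset.filter_not, Finset.filter_eq', if_pos (Finset.mem_univ _),
    Finset.card_sdiff_of_subset (by simp), Finset.card_univ, Finset.card_singleton,
    Fintype.card_fun, ZMod.card, Fintype.card_fin, nsmul_eq_mul, mul_one,
    Nat.cast_sub (Nat.one_le_pow _ _ (by norm_num))] at hsum
  -- The sum of values is 3^(dim L) - 1 = -1, not 0.
  have h3 : ((3 : ℕ) : ZMod 3) = 0 := by decide
  rw [Nat.cast_pow, h3, zero_pow (by omega)] at hsum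
  exact absurd hsum (by decide)

/-- The dimension bound for brackets over `ZMod 3`. -/
theorem isCaminaBracket_of_three {V W : Type*} [AddCommGroup V] [Module (ZMod 3) V]
    [FiniteDimensional (ZMod 3) V] [AddCommGroup W] [Module (ZMod 3) W]
    [FiniteDimensional (ZMod 3) W] (hV : 0 < finrank (ZMod 3) V)
    (br : V →ₗ[ZMod 3] V →ₗ[ZMod 3] W) (halt : ∀ x, br x x = 0)
    (hsurj : ∀ x, x ≠ 0 → Function.Surjective (br x)) : IsCaminaBracket br where
  alt := halt
  surj := hsurj
  two_mul_finrank_le := by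
    -- Each functional on W gives an alternating form on V, nondegenerate by surjectivity of the
    -- bracket.
    have h := two_mul_finrank_le_of_alternating_family (L := Dual (ZMod 3) W) hV
      { toFun := fun l => br.compr₂ l
        map_add' := fun _ _ => rfl
        map_smul' := fun _ _ => rfl } (fun l a => by
          change l (br a a) = 0
          rw [halt, map_zero]) (fun l a hl ha => by
          by_contra! hc
          apply hl
          ext w
          obtain ⟨a', rfl⟩ := hsurj a ha w
          exact hc a')
    rwa [Subspace.dual_finrank_eq] at h

end AlternatingFamily

/-! ### Gauss sums and the case of two elements. -/

section QuadraticMap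

/-- The nontrivial sign character of `ZMod 2`. -/
def signChar (a : ZMod 2) : ℤ := if a = 0 then 1 else -1

theorem signChar_zero : signChar 0 = 1 := rfl

theorem signChar_add (a b : ZMod 2) : signChar (a + b) = signChar a * signChar b := by
  revert a b; decide

theorem sum_signChar_eq_zero {M : Type*} [AddCommGroup M] [Fintype M] [Module (ZMod 2) M]
    (φ : M →ₗ[ZMod 2] ZMod 2) (hφ : φ ≠ 0) : ∑ x, signChar (φ x) = 0 := by
  obtain ⟨x₀, hx₀⟩ : ∃ x, φ x ≠ 0 := by
    by_contra! hc
    exact hφ (LinearMap.ext hc)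
  have h1 : ∑ x, signChar (φ x) = ∑ x, signChar (φ (x₀ + x)) :=
    (Equiv.sum_comp (Equiv.addLeft x₀) fun x => signChar (φ x)).symm
  have h2 : signChar (φ x₀) = -1 := if_neg hx₀
  simp only [map_add, signChar_add, h2, ← Finset.mul_sum] at h1
  linarith

variable {V W : Type*} [AddCommGroup V] [Module (ZMod 2) V] [FiniteDimensional (ZMod 2) V]
  [AddCommGroup W] [Module (ZMod 2) W] [FiniteDimensional (ZMod 2) W]

/-- Substituting y = x + z turns the summand into χ(l(q z)) χ(l[x, z]). For z ≠ 0 the second factor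
is a nontrivial character of x and sums to zero. -/
theorem sq_sum_signChar [Fintype V] (br : V →ₗ[ZMod 2] V →ₗ[ZMod 2] W) (halt : ∀ x, br x x = 0)
    (hsurj : ∀ x, x ≠ 0 → Function.Surjective (br x)) (q : V → W)
    (hq : ∀ x y, q (x + y) = q x + q y + br x y) (l : W →ₗ[ZMod 2] ZMod 2) (hl : l ≠ 0) :
    (∑ x, signChar (l (q x))) ^ 2 = Fintype.card V := by
  classical
  have hq0 : q 0 = 0 := by
    have := hq 0 0
    rwa [add_zero, map_zero, add_zero, left_eq_add] at this
  have h1 : ∀ x z, signChar (l (q x)) * signChar (l (q (x + z))) =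
      signChar (l (q z)) * signChar (l (br.flip z x)) := by
    intro x z
    rw [← signChar_add, ← signChar_add, hq, map_add, map_add, LinearMap.flip_apply]
    congr 1
    rw [← add_assoc, ← add_assoc, CharTwo.add_self_eq_zero, zero_add]
  have h2 : ∀ z, ∑ x, signChar (l (br.flip z x)) = if z = 0 then (Fintype.card V : ℤ) else 0 := by
    intro z
    split_ifs with hz
    · simp [hz, signChar_zero]
    · refine sum_signChar_eq_zero (l ∘ₗ br.flip z) fun h0 => hl ?_
      ext w
      obtain ⟨x, rfl⟩ := hsurj z hz w
      have e : br z x = -br x z := by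
        have := halt (z + x)
        simp only [map_add, LinearMap.add_apply, halt, zero_add, add_zero] at this
        exact eq_neg_of_add_eq_zero_right this
      have := LinearMap.congr_fun h0 x
      rw [e, map_neg, LinearMap.zero_apply, neg_eq_zero]
      exact this
  calc (∑ x, signChar (l (q x))) ^ 2
      = ∑ x, ∑ y, signChar (l (q x)) * signChar (l (q y)) := by
        rw [sq, Finset.sum_mul_sum]
    _ = ∑ x, ∑ z, signChar (l (q x)) * signChar (l (q (x + z))) := by
        refine Finset.sum_congr rfl fun x _ => ?_
        exact (Equiv.sum_comp (Equiv.addLeft x)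
          fun y => signChar (l (q x)) * signChar (l (q y))).symm
    _ = ∑ z, signChar (l (q z)) * ∑ x, signChar (l (br.flip z x)) := by
        simp only [h1]
        rw [Finset.sum_comm]
        simp only [Finset.mul_sum]
    _ = Fintype.card V := by
        simp only [h2, mul_ite, mul_zero]
        rw [Finset.sum_ite_eq' Finset.univ (0 : V), if_pos (Finset.mem_univ _), hq0, map_zero,
          signChar_zero, one_mul]

/-- The dimension bound for brackets over `ZMod 2` which polarise a quadratic map. -/
theorem isCaminaBracket_of_two (hV : 0 < finrank (ZMod 2) V)
    (br : V →ₗ[ZMod 2] V →ₗ[ZMod 2] W) (halt : ∀ x, br x x = 0)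
    (hsurj : ∀ x, x ≠ 0 → Function.Surjective (br x)) (q : V → W)
    (hq : ∀ x y, q (x + y) = q x + q y + br x y) : IsCaminaBracket br where
  alt := halt
  surj := hsurj
  two_mul_finrank_le := by
    classical
    have := Module.finite_of_finite (ZMod 2) (M := V)
    have := Module.finite_of_finite (ZMod 2) (M := Dual (ZMod 2) W)
    have := Fintype.ofFinite V
    have := Fintype.ofFinite (Dual (ZMod 2) W)
    by_contra! hlt
    have hcV : (Fintype.card V : ℤ) = 2 ^ finrank (ZMod 2) V := by
      rw [← Nat.card_eq_fintype_card, Module.natCard_eq_pow_finrank (K := ZMod 2), Nat.card_zmod]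
      norm_cast
    have hcW : (Fintype.card (Dual (ZMod 2) W)) = 2 ^ finrank (ZMod 2) W := by
      rw [← Nat.card_eq_fintype_card, Module.natCard_eq_pow_finrank (K := ZMod 2), Nat.card_zmod,
        Subspace.dual_finrank_eq]
    set S : Dual (ZMod 2) W → ℤ := fun l => ∑ x, signChar (l (q x)) with hS
    have hsq : ∀ l, l ≠ 0 → S l ^ 2 = 2 ^ finrank (ZMod 2) V := fun l hl => by
      rw [← hcV]; exact sq_sum_signChar br halt hsurj q hq l hl
    -- A Gauss sum whose square is 2^(dim V) is ±2^(dim V / 2); the factor 1 + 2t records the sign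
    -- with t = 0 or -1.
    have hval : ∀ l, l ≠ 0 → ∃ t, S l = 2 ^ (finrank (ZMod 2) V / 2) * (1 + 2 * t) ∧
        finrank (ZMod 2) V = 2 * (finrank (ZMod 2) V / 2) := by
      intro l hl
      have h1 : (S l).natAbs ^ 2 = 2 ^ finrank (ZMod 2) V := by
        zify; rw [sq_abs]; exact hsq l hl
      obtain ⟨k, -, hk⟩ := (Nat.dvd_prime_pow Nat.prime_two).1
        (h1 ▸ Dvd.intro_left _ (pow_succ (S l).natAbs 1).symm)
      rw [hk, ← pow_mul] at h1
      have h2 := Nat.pow_right_injective le_rfl h1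
      have h3 : finrank (ZMod 2) V / 2 = k := by omega
      rw [h3]
      rcases Int.natAbs_eq (S l) with h | h
      · exact ⟨0, by rw [h, hk]; push_cast; ring, by omega⟩
      · exact ⟨-1, by rw [h, hk]; push_cast; ring, by omega⟩
    choose! t ht using hval
    -- Summing over l first detects the zeros of q, so the total is divisible by 2^(dim W).
    have hsum : ∑ l, S l = 2 ^ finrank (ZMod 2) W *
        ((Finset.univ.filter fun x => q x = 0).card : ℤ) := by
      rw [hS, Finset.sum_comm]
      have : ∀ x, ∑ l : Dual (ZMod 2) W, signChar (l (q x)) =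
          if q x = 0 then (2 : ℤ) ^ finrank (ZMod 2) W else 0 := by
        intro x
        split_ifs with hx
        · simp [hx, signChar_zero, hcW]
        · refine sum_signChar_eq_zero (Dual.eval (ZMod 2) W (q x)) fun h0 => hx ?_
          rw [← Module.forall_dual_apply_eq_zero_iff (ZMod 2)]
          exact fun l => LinearMap.congr_fun h0 l
      simp only [this]
      rw [Finset.sum_ite, Finset.sum_const_zero, add_zero, Finset.sum_const, nsmul_eq_mul, mul_comm]
    have hS0 : S 0 = 2 ^ finrank (ZMod 2) V := by
      simp [hS, signChar_zero, hcV]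
    have hm : 0 < finrank (ZMod 2) W := by omega
    obtain ⟨l₀, hl₀⟩ : ∃ l : Dual (ZMod 2) W, l ≠ 0 := by
      rw [← Subspace.dual_finrank_eq] at hm
      exact Module.finrank_pos_iff_exists_ne_zero.1 hm
    have heven := (ht l₀ hl₀).2
    have hk : ∃ k, finrank (ZMod 2) V / 2 = k + 1 := ⟨finrank (ZMod 2) V / 2 - 1, by omega⟩
    obtain ⟨k, hk⟩ := hk
    have hV2 : finrank (ZMod 2) V = k + 1 + (k + 1) := by omega
    obtain ⟨j, hj⟩ : ∃ j, finrank (ZMod 2) W = k + 1 + (j + 1) :=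
      ⟨finrank (ZMod 2) W - k - 2, by omega⟩
    rw [← Finset.add_sum_erase _ _ (Finset.mem_univ (0 : Dual (ZMod 2) W)), hS0,
      Finset.sum_congr rfl fun l hl => (ht l (Finset.ne_of_mem_erase hl)).1, ← Finset.mul_sum,
      Finset.sum_add_distrib, ← Finset.mul_sum, Finset.sum_const, Finset.card_erase_of_mem
      (Finset.mem_univ _), Finset.card_univ, hcW, hk, hV2, hj, nsmul_eq_mul, mul_one,
      Nat.cast_sub Nat.one_le_two_pow, pow_add _ (k + 1) (k + 1),
      ← mul_add] at hsum
    push_cast at hsum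
    rw [pow_add _ (k + 1) (j + 1), mul_assoc] at hsum
    have h2 := mul_left_cancel₀ (pow_ne_zero _ two_ne_zero) hsum
    rw [pow_succ, pow_succ (2 : ℤ) j] at h2
    generalize ((Finset.univ.filter fun x => q x = 0).card : ℤ) = c at h2
    generalize ∑ l ∈ Finset.univ.erase 0, t l = d at h2
    -- After division by 2^(dim V / 2) one side is odd and the other even, since dim W > dim V / 2 >
    -- 0.
    have : (2 : ℤ) * (2 ^ k + 2 ^ k * 2 ^ j * 2 + d - 2 ^ j * c) = 1 := by linear_combination h2
    omega

/-- A triple bracket on a Camina bracket over `ZMod 2` which is compatible with the squaring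
maps `q` and `s` vanishes. -/
theorem tripleBracket_eq_zero_of_two {br : V →ₗ[ZMod 2] V →ₗ[ZMod 2] W}
    {f : W →ₗ[ZMod 2] V →ₗ[ZMod 2] ZMod 2} (hb : IsCaminaBracket br) (hj : IsJacobi br f)
    (q : V → W) (s : W →ₗ[ZMod 2] ZMod 2)
    (hrel : ∀ x y, f (q x) y = s (br x y) + f (br x y) x)
    (hC : ∀ a ∈ LinearMap.ker f.flip, a ≠ 0 → ∃ y, br a y = 0 ∧ y ≠ 0 ∧ y ≠ a) : f = 0 := by
  by_contra hf
  obtain ⟨hN, hA⟩ := hb.finrank_data hj hf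
  have hm : 0 < finrank (ZMod 2) W := IsCaminaBracket.finrank_pos (V := V) hf
  -- For x outside A = `ker f.flip` the map a ↦ [a, x] is injective on A, hence onto W. Evaluating
  -- `hrel` at (x, a), where its left side vanishes, identifies `f.flip x` with s on all of W.
  have key : ∀ x, x ∉ LinearMap.ker f.flip → f.flip x = s := by
    intro x hx
    have hmap : (LinearMap.ker f.flip).map (br.flip x) = ⊤ := by
      apply Submodule.eq_top_of_finrank_eq
      have h1 := finrank_map_add_finrank_inf_ker (br.flip x) (LinearMap.ker f.flip)
      have h2 : LinearMap.ker f.flip ⊓ LinearMap.ker (br.flip x) = ⊥ := by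
        rw [eq_bot_iff]
        intro a ha
        by_contra ha0
        apply hx
        rw [← hb.ker_eq hj hf ha.1 ha0]
        exact ha.2
      rw [h2, finrank_bot, add_zero, hA] at h1
      exact h1
    ext w
    obtain ⟨a, ha, rfl⟩ : w ∈ (LinearMap.ker f.flip).map (br.flip x) := hmap ▸ Submodule.mem_top
    have h1 := hrel x a
    have h2 : f (q x) a = 0 := LinearMap.congr_fun (LinearMap.mem_ker.1 ha) _
    rw [h2, hb.neg_swap x a] at h1
    simp only [map_neg, LinearMap.neg_apply] at h1
    change f (br a x) x = s (br a x)
    have h3 : f (br a x) x + s (br a x) = 0 := by linear_combination h1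
    rw [← CharTwo.sub_eq_add] at h3
    exact sub_eq_zero.1 h3
  -- Thus the surjection `f.flip` takes only the values 0 and s, so dim W ≤ 1. Then A has just two
  -- elements, too few for the vector y from `hC`.
  have hle : (⊤ : Submodule (ZMod 2) (Dual (ZMod 2) W)) ≤ Submodule.span (ZMod 2) {s} := by
    intro l _
    obtain ⟨x, rfl⟩ := hb.flip_surjective hj hf l
    by_cases hx : x ∈ LinearMap.ker f.flip
    · rw [LinearMap.mem_ker.1 hx]
      exact zero_mem _
    · rw [key x hx]
      exact Submodule.mem_span_singleton_self s
  have h1 := (Submodule.finrank_mono hle).trans (finrank_span_le_card {s})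
  rw [finrank_top, Subspace.dual_finrank_eq, Set.toFinset_singleton, Finset.card_singleton] at h1
  obtain ⟨⟨a, ha⟩, ha0⟩ := Module.finrank_pos_iff_exists_ne_zero.1 (hA ▸ hm)
  have ha0' : a ≠ 0 := fun e => ha0 (Subtype.ext e)
  obtain ⟨y, hy, hy0, hya⟩ := hC a ha ha0'
  have hyA : y ∈ LinearMap.ker f.flip := by
    rw [← hb.ker_eq hj hf ha ha0']
    exact hy
  have h2 : finrank (ZMod 2) (LinearMap.ker f.flip) = 1 := by omega
  obtain ⟨c, hc⟩ := (finrank_eq_one_iff_of_nonzero' (⟨a, ha⟩ : LinearMap.ker f.flip) ha0).1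
    h2 ⟨y, hyA⟩
  have hc' : c • a = y := congrArg Subtype.val hc
  have h01 : ∀ c : ZMod 2, c = 0 ∨ c = 1 := by decide
  rcases h01 c with rfl | rfl
  · exact hy0 (by rw [← hc', zero_smul])
  · exact hya (by rw [← hc', one_smul])

end QuadraticMap

/-! ### Functionals on central factors and the identities they satisfy. -/

section InvariantHom

variable {G : Type*} [Group G]

theorem three_subgroups_le {A B C N : Subgroup G} [N.Normal] (h1 : ⁅⁅B, C⁆, A⁆ ≤ N)
    (h2 : ⁅⁅C, A⁆, B⁆ ≤ N) : ⁅⁅A, B⁆, C⁆ ≤ N := by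
  have key : ∀ K : Subgroup G, K.map (QuotientGroup.mk' N) = ⊥ ↔ K ≤ N := by
    intro K
    rw [Subgroup.map_eq_bot_iff, QuotientGroup.ker_mk']
  rw [← key, Subgroup.map_commutator, Subgroup.map_commutator] at h1 h2 ⊢
  exact Subgroup.commutator_commutator_eq_bot_of_rotate h1 h2

/-- Gives [G', D] ≤ [D, G, G]: [γ₂, γ₂] ≤ γ₄ for D = γ₂ and [γ₂, γ₃] ≤ γ₅ for D = γ₃. -/
theorem commutator_top_top_le (D : Subgroup G) [D.Normal] :
    ⁅⁅(⊤ : Subgroup G), (⊤ : Subgroup G)⁆, D⁆ ≤ ⁅⁅D, (⊤ : Subgroup G)⁆, (⊤ : Subgroup G)⁆ := by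
  refine three_subgroups_le ?_ ?_
  · rw [Subgroup.commutator_comm (⊤ : Subgroup G) D]
  · exact le_rfl

/-- A function on `G` whose restriction to the subgroup `C` is a homomorphism to an additive group
which is invariant under conjugation by `G`. -/
structure IsInvariantHom {A : Type*} [AddCommGroup A] (C : Subgroup G) (θ : G → A) : Prop where
  map_mul : ∀ a ∈ C, ∀ b ∈ C, θ (a * b) = θ a + θ b
  map_conj : ∀ g, ∀ c ∈ C, θ (g * c * g⁻¹) = θ c

namespace IsInvariantHom

variable {A : Type*} [AddCommGroup A] {C : Subgroup G} {θ : G → A}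

theorem map_one (h : IsInvariantHom C θ) : θ 1 = 0 := by
  have := h.map_mul 1 C.one_mem 1 C.one_mem
  rwa [mul_one, left_eq_add] at this

theorem map_inv (h : IsInvariantHom C θ) {c : G} (hc : c ∈ C) : θ c⁻¹ = -θ c := by
  have := h.map_mul c hc c⁻¹ (C.inv_mem hc)
  rw [mul_inv_cancel, h.map_one] at this
  exact (neg_eq_of_add_eq_zero_right this.symm).symm

theorem map_pow (h : IsInvariantHom C θ) {c : G} (hc : c ∈ C) (n : ℕ) : θ (c ^ n) = n • θ c := by
  induction n with
  | zero => rw [pow_zero, h.map_one, zero_smul]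
  | succ n ih => rw [pow_succ, h.map_mul _ (C.pow_mem hc n) _ hc, ih, succ_nsmul]

theorem map_commutator_eq_zero (h : IsInvariantHom C θ) [hC : C.Normal] {c : G}
    (hc : c ∈ ⁅C, (⊤ : Subgroup G)⁆) : θ c = 0 := by
  let K : Subgroup G :=
    { carrier := {c | c ∈ C ∧ θ c = 0}
      one_mem' := ⟨C.one_mem, h.map_one⟩
      mul_mem' := fun {a b} ha hb => ⟨C.mul_mem ha.1 hb.1, by
        rw [h.map_mul _ ha.1 _ hb.1, ha.2, hb.2, add_zero]⟩
      inv_mem' := fun {a} ha => ⟨C.inv_mem ha.1, by rw [h.map_inv ha.1, ha.2, neg_zero]⟩ }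
  have hle : ⁅C, (⊤ : Subgroup G)⁆ ≤ K := by
    rw [Subgroup.commutator_le]
    intro a ha g _
    have h1 : g * a⁻¹ * g⁻¹ ∈ C := hC.conj_mem _ (C.inv_mem ha) g
    have e : ⁅a, g⁆ = a * (g * a⁻¹ * g⁻¹) := by simp only [commutatorElement_def, mul_assoc]
    refine ⟨?_, ?_⟩
    · rw [e]; exact C.mul_mem ha h1
    · rw [e, h.map_mul _ ha _ h1, h.map_conj _ _ (C.inv_mem ha), h.map_inv ha, add_neg_cancel]
  exact (hle hc).2

theorem commutator_mul_left (h : IsInvariantHom C θ) [hC : C.Normal] {a b c : G}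
    (hac : ⁅a, c⁆ ∈ C) (hbc : ⁅b, c⁆ ∈ C) : θ ⁅a * b, c⁆ = θ ⁅a, c⁆ + θ ⁅b, c⁆ := by
  have e : ⁅a * b, c⁆ = (a * ⁅b, c⁆ * a⁻¹) * ⁅a, c⁆ := by
    simp [commutatorElement_def, mul_assoc]
  rw [e, h.map_mul _ (hC.conj_mem _ hbc a) _ hac, h.map_conj _ _ hbc, add_comm]

theorem commutator_swap (h : IsInvariantHom C θ) {a b : G} (hab : ⁅a, b⁆ ∈ C) :
    θ ⁅b, a⁆ = -θ ⁅a, b⁆ := by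
  rw [← commutatorElement_inv, h.map_inv hab]

theorem commutator_mul_right (h : IsInvariantHom C θ) [hC : C.Normal] {a b c : G}
    (hab : ⁅a, b⁆ ∈ C) (hac : ⁅a, c⁆ ∈ C) : θ ⁅a, b * c⁆ = θ ⁅a, b⁆ + θ ⁅a, c⁆ := by
  have e : ⁅a, b * c⁆ = ⁅a, b⁆ * (b * ⁅a, c⁆ * b⁻¹) := by
    simp [commutatorElement_def, mul_assoc]
  rw [e, h.map_mul _ hab _ (hC.conj_mem _ hac b), h.map_conj _ _ hac]

/-- Allows descent of one step in the series: a functional on the lower term gives, for each v, one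
on the term above. -/
theorem commutator_left (h : IsInvariantHom C θ) [hC : C.Normal] {D : Subgroup G}
    (hDC : ⁅D, (⊤ : Subgroup G)⁆ ≤ C) (v : G) : IsInvariantHom D fun d => θ ⁅d, v⁆ where
  map_mul a ha b hb := h.commutator_mul_left
    (hDC (Subgroup.commutator_mem_commutator ha (Subgroup.mem_top v)))
    (hDC (Subgroup.commutator_mem_commutator hb (Subgroup.mem_top v)))
  map_conj g d hd := by
    have e : g * d * g⁻¹ = ⁅g, d⁆ * d := by simp [commutatorElement_def]
    have hgd : ⁅g, d⁆ ∈ C := by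
      rw [← commutatorElement_inv]
      exact C.inv_mem (hDC (Subgroup.commutator_mem_commutator hd (Subgroup.mem_top g)))
    have hgdv : ⁅⁅g, d⁆, v⁆ ∈ ⁅C, (⊤ : Subgroup G)⁆ :=
      Subgroup.commutator_mem_commutator hgd (Subgroup.mem_top v)
    rw [e, h.commutator_mul_left (Subgroup.commutator_le_left C ⊤ hgdv)
      (hDC (Subgroup.commutator_mem_commutator hd (Subgroup.mem_top v))),
      h.map_commutator_eq_zero hgdv, zero_add]

/-- The Jacobi identity obtained from the Hall–Witt identity. -/
theorem jacobi (h : IsInvariantHom C θ) [hC : C.Normal] {a b c : G}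
    (h1 : ⁅⁅a, b⁆, c⁆ ∈ C) (h2 : ⁅⁅b, c⁆, a⁆ ∈ C) (h3 : ⁅⁅c, a⁆, b⁆ ∈ C)
    (h1' : ⁅⁅a, b⁆, ⁅b, c⁆⁆ ∈ ⁅C, (⊤ : Subgroup G)⁆)
    (h2' : ⁅⁅b, c⁆, ⁅c, a⁆⁆ ∈ ⁅C, (⊤ : Subgroup G)⁆)
    (h3' : ⁅⁅c, a⁆, ⁅a, b⁆⁆ ∈ ⁅C, (⊤ : Subgroup G)⁆) :
    θ ⁅⁅a, b⁆, c⁆ + θ ⁅⁅b, c⁆, a⁆ + θ ⁅⁅c, a⁆, b⁆ = 0 := by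
  have hle := Subgroup.commutator_le_left C (⊤ : Subgroup G)
  -- Hall-Witt has y z y⁻¹ = [y, z] z in place of z. The extra factor lies in [C, G], on which θ
  -- vanishes.
  have key : ∀ x y z : G, ⁅⁅x, y⁆, z⁆ ∈ C → ⁅⁅x, y⁆, ⁅y, z⁆⁆ ∈ ⁅C, (⊤ : Subgroup G)⁆ →
      ⁅⁅x, y⁆, y * z * y⁻¹⁆ ∈ C ∧ θ ⁅⁅x, y⁆, y * z * y⁻¹⁆ = θ ⁅⁅x, y⁆, z⁆ := by
    intro x y z hz hyz
    have e : y * z * y⁻¹ = ⁅y, z⁆ * z := by simp [commutatorElement_def]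
    have e2 : ⁅⁅x, y⁆, ⁅y, z⁆ * z⁆ =
        ⁅⁅x, y⁆, ⁅y, z⁆⁆ * (⁅y, z⁆ * ⁅⁅x, y⁆, z⁆ * ⁅y, z⁆⁻¹) := by
      simp [commutatorElement_def, mul_assoc]
    rw [e]
    refine ⟨?_, ?_⟩
    · rw [e2]
      exact C.mul_mem (hle hyz) (hC.conj_mem _ hz _)
    · rw [h.commutator_mul_right (hle hyz) hz, h.map_commutator_eq_zero hyz, zero_add]
  obtain ⟨m1, e1⟩ := key a b c h1 h1'
  obtain ⟨m2, e2⟩ := key b c a h2 h2'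
  obtain ⟨m3, e3⟩ := key c a b h3 h3'
  have hw := congrArg θ (commutatorElement_commutatorElement_conj_mul a b c)
  rwa [h.map_mul _ (C.mul_mem m1 m2) _ m3, h.map_mul _ m1 _ m2, e1, e2, e3, h.map_one] at hw

end IsInvariantHom

end InvariantHom

/-! ### Passing from functions on subgroups to multilinear maps on quotients. -/

section Covers

variable {G : Type*} [Group G]

/-- A function on `G` whose restriction to `C` is a homomorphism onto the additive group `Q`. -/
structure IsCover {Q : Type*} [AddCommGroup Q] (C : Subgroup G) (π : G → Q) : Prop where
  map_mul : ∀ a ∈ C, ∀ b ∈ C, π (a * b) = π a + π b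
  surj : ∀ q, ∃ c ∈ C, π c = q

namespace IsCover

variable {p : ℕ} {Q₁ Q₂ Q₃ A : Type*} [AddCommGroup Q₁] [AddCommGroup Q₂] [AddCommGroup Q₃]
  [AddCommGroup A] [Module (ZMod p) Q₁] [Module (ZMod p) Q₂] [Module (ZMod p) Q₃]
  [Module (ZMod p) A]
  {C₁ C₂ C₃ : Subgroup G} {π₁ : G → Q₁} {π₂ : G → Q₂} {π₃ : G → Q₃}

theorem map_one {C : Subgroup G} {π : G → Q₁} (h : IsCover C π) : π 1 = 0 := by
  have := h.map_mul 1 C.one_mem 1 C.one_mem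
  rwa [mul_one, left_eq_add] at this

theorem map_inv {C : Subgroup G} {π : G → Q₁} (h : IsCover C π) {c : G} (hc : c ∈ C) :
    π c⁻¹ = -π c := by
  have := h.map_mul c hc c⁻¹ (C.inv_mem hc)
  rw [mul_inv_cancel, h.map_one] at this
  exact (neg_eq_of_add_eq_zero_right this.symm).symm

theorem exists_linear (h₁ : IsCover C₁ π₁) (φ : G → A)
    (hφ : ∀ a ∈ C₁, ∀ b ∈ C₁, φ (a * b) = φ a + φ b) (hk : ∀ c ∈ C₁, π₁ c = 0 → φ c = 0) :
    ∃ L : Q₁ →ₗ[ZMod p] A, ∀ c ∈ C₁, L (π₁ c) = φ c := by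
  choose s hs hπ using h₁.surj
  have hφ1 : φ 1 = 0 := by
    have := hφ 1 C₁.one_mem 1 C₁.one_mem
    rwa [mul_one, left_eq_add] at this
  have key : ∀ a ∈ C₁, ∀ b ∈ C₁, π₁ a = π₁ b → φ a = φ b := by
    intro a ha b hb hab
    have h1 : φ (a * b⁻¹) = 0 := by
      apply hk _ (C₁.mul_mem ha (C₁.inv_mem hb))
      rw [h₁.map_mul _ ha _ (C₁.inv_mem hb), h₁.map_inv hb, hab, add_neg_cancel]
    have h2 := hφ _ (C₁.mul_mem ha (C₁.inv_mem hb)) _ hb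
    rwa [inv_mul_cancel_right, h1, zero_add] at h2
  refine ⟨AddMonoidHom.toZModLinearMap p (AddMonoidHom.mk' (fun q => φ (s q)) fun q q' => ?_), ?_⟩
  · rw [← hφ _ (hs q) _ (hs q')]
    apply key _ (hs _) _ (C₁.mul_mem (hs q) (hs q'))
    rw [h₁.map_mul _ (hs q) _ (hs q'), hπ, hπ, hπ]
  · intro c hc
    exact key _ (hs _) _ hc (hπ _)

theorem exists_bilinear (h₁ : IsCover C₁ π₁) (h₂ : IsCover C₂ π₂) (φ : G → G → A)
    (hφ₁ : ∀ a ∈ C₁, ∀ b ∈ C₁, ∀ c ∈ C₂, φ (a * b) c = φ a c + φ b c)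
    (hφ₂ : ∀ a ∈ C₁, ∀ b ∈ C₂, ∀ c ∈ C₂, φ a (b * c) = φ a b + φ a c)
    (hk₁ : ∀ a ∈ C₁, ∀ b ∈ C₂, π₁ a = 0 → φ a b = 0)
    (hk₂ : ∀ a ∈ C₁, ∀ b ∈ C₂, π₂ b = 0 → φ a b = 0) :
    ∃ L : Q₁ →ₗ[ZMod p] Q₂ →ₗ[ZMod p] A, ∀ a ∈ C₁, ∀ b ∈ C₂, L (π₁ a) (π₂ b) = φ a b := by
  have h : ∀ a, ∃ L : Q₂ →ₗ[ZMod p] A, a ∈ C₁ → ∀ b ∈ C₂, L (π₂ b) = φ a b := by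
    intro a
    by_cases ha : a ∈ C₁
    · obtain ⟨L, hL⟩ := h₂.exists_linear (p := p) (φ a) (hφ₂ a ha) (hk₂ a ha)
      exact ⟨L, fun _ => hL⟩
    · exact ⟨0, fun h => absurd h ha⟩
  choose L hL using h
  obtain ⟨M, hM⟩ := h₁.exists_linear (p := p) L (fun a ha b hb => by
      ext q
      obtain ⟨c, hc, rfl⟩ := h₂.surj q
      rw [LinearMap.add_apply, hL _ (C₁.mul_mem ha hb) c hc, hL a ha c hc, hL b hb c hc,
        hφ₁ a ha b hb c hc]) (fun a ha ha0 => by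
      ext q
      obtain ⟨c, hc, rfl⟩ := h₂.surj q
      rw [hL a ha c hc, hk₁ a ha c hc ha0, LinearMap.zero_apply])
  exact ⟨M, fun a ha b hb => by rw [hM a ha, hL a ha b hb]⟩

theorem exists_trilinear (h₁ : IsCover C₁ π₁) (h₂ : IsCover C₂ π₂) (h₃ : IsCover C₃ π₃)
    (φ : G → G → G → A)
    (hφ₁ : ∀ a ∈ C₁, ∀ b ∈ C₁, ∀ c ∈ C₂, ∀ d ∈ C₃, φ (a * b) c d = φ a c d + φ b c d)
    (hφ₂ : ∀ a ∈ C₁, ∀ b ∈ C₂, ∀ c ∈ C₂, ∀ d ∈ C₃, φ a (b * c) d = φ a b d + φ a c d)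
    (hφ₃ : ∀ a ∈ C₁, ∀ b ∈ C₂, ∀ c ∈ C₃, ∀ d ∈ C₃, φ a b (c * d) = φ a b c + φ a b d)
    (hk₁ : ∀ a ∈ C₁, ∀ b ∈ C₂, ∀ c ∈ C₃, π₁ a = 0 → φ a b c = 0)
    (hk₂ : ∀ a ∈ C₁, ∀ b ∈ C₂, ∀ c ∈ C₃, π₂ b = 0 → φ a b c = 0)
    (hk₃ : ∀ a ∈ C₁, ∀ b ∈ C₂, ∀ c ∈ C₃, π₃ c = 0 → φ a b c = 0) :
    ∃ L : Q₁ →ₗ[ZMod p] Q₂ →ₗ[ZMod p] Q₃ →ₗ[ZMod p] A,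
      ∀ a ∈ C₁, ∀ b ∈ C₂, ∀ c ∈ C₃, L (π₁ a) (π₂ b) (π₃ c) = φ a b c := by
  have h : ∀ a, ∃ L : Q₂ →ₗ[ZMod p] Q₃ →ₗ[ZMod p] A,
      a ∈ C₁ → ∀ b ∈ C₂, ∀ c ∈ C₃, L (π₂ b) (π₃ c) = φ a b c := by
    intro a
    by_cases ha : a ∈ C₁
    · obtain ⟨L, hL⟩ := h₂.exists_bilinear (p := p) h₃ (φ a) (hφ₂ a ha) (hφ₃ a ha) (hk₂ a ha)
        (hk₃ a ha)
      exact ⟨L, fun _ => hL⟩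
    · exact ⟨0, fun h => absurd h ha⟩
  choose L hL using h
  obtain ⟨M, hM⟩ := h₁.exists_linear (p := p) L (fun a ha b hb => by
      ext q r
      obtain ⟨c, hc, rfl⟩ := h₂.surj q
      obtain ⟨d, hd, rfl⟩ := h₃.surj r
      rw [LinearMap.add_apply, LinearMap.add_apply, hL _ (C₁.mul_mem ha hb) c hc d hd,
        hL a ha c hc d hd, hL b hb c hc d hd, hφ₁ a ha b hb c hc d hd]) (fun a ha ha0 => by
      ext q r
      obtain ⟨c, hc, rfl⟩ := h₂.surj q
      obtain ⟨d, hd, rfl⟩ := h₃.surj r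
      rw [hL a ha c hc d hd, hk₁ a ha c hc d hd ha0, LinearMap.zero_apply, LinearMap.zero_apply])
  exact ⟨M, fun a ha b hb c hc => by rw [hM a ha, hL a ha b hb c hc]⟩

end IsCover

end Covers

/-! ### Central factors of exponent p and the Camina condition. -/

section Layers

universe u

variable {G : Type*} [Group G]

theorem IsInvariantHom.isCover {Q : Type*} [AddCommGroup Q] {C : Subgroup G} {π : G → Q}
    (h : IsInvariantHom C π) (hs : ∀ q, ∃ c ∈ C, π c = q) : IsCover C π :=
  ⟨h.map_mul, hs⟩

/-- The factor `C / [C, G]` as a vector space over `ZMod p`. -/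
theorem exists_layer {G : Type u} [Group G] (p : ℕ) (C : Subgroup G) [hC : C.Normal]
    (hp : ∀ c ∈ C, c ^ p ∈ ⁅C, (⊤ : Subgroup G)⁆) :
    ∃ (Q : Type u) (_ : AddCommGroup Q) (_ : Module (ZMod p) Q) (π : G → Q),
      IsInvariantHom C π ∧ (∀ q, ∃ c ∈ C, π c = q) ∧
        ∀ c ∈ C, π c = 0 → c ∈ ⁅C, (⊤ : Subgroup G)⁆ := by
  classical
  let K : Subgroup C := ⁅C, (⊤ : Subgroup G)⁆.subgroupOf C
  have hcomm : ∀ a b : C ⧸ K, a * b = b * a := by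
    intro a b
    induction a using QuotientGroup.induction_on with | _ a =>
    induction b using QuotientGroup.induction_on with | _ b =>
    rw [← QuotientGroup.mk_mul, ← QuotientGroup.mk_mul, QuotientGroup.eq, Subgroup.mem_subgroupOf]
    have e : (((a * b)⁻¹ * (b * a) : C) : G) = ⁅(b⁻¹ : G), (a⁻¹ : G)⁆ := by
      simp [commutatorElement_def, mul_assoc]
    rw [e]
    exact Subgroup.commutator_mem_commutator (C.inv_mem b.2) (Subgroup.mem_top _)
  let _ : CommGroup (C ⧸ K) := { (inferInstance : Group (C ⧸ K)) with mul_comm := hcomm }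
  have hpQ : ∀ x : Additive (C ⧸ K), p • x = 0 := by
    intro x
    change (Additive.toMul x) ^ p = 1
    induction (Additive.toMul x) using QuotientGroup.induction_on with | _ a =>
    rw [← QuotientGroup.mk_pow, QuotientGroup.eq_one_iff, Subgroup.mem_subgroupOf]
    exact hp a a.2
  refine ⟨Additive (C ⧸ K), inferInstance, AddCommGroup.zmodModule hpQ,
    fun g => if h : g ∈ C then Additive.ofMul (QuotientGroup.mk (s := K) ⟨g, h⟩) else 0,
    ⟨?_, ?_⟩, ?_, ?_⟩
  · intro a ha b hb
    rw [dif_pos ha, dif_pos hb, dif_pos (C.mul_mem ha hb)]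
    rfl
  · intro g c hc
    rw [dif_pos hc, dif_pos (hC.conj_mem c hc g)]
    congr 1
    rw [QuotientGroup.eq, Subgroup.mem_subgroupOf]
    have e : ((⟨g * c * g⁻¹, hC.conj_mem c hc g⟩⁻¹ * ⟨c, hc⟩ : C) : G) = ⁅g, c⁻¹⁆ := by
      simp [commutatorElement_def, mul_assoc]
    rw [e, Subgroup.commutator_comm]
    exact Subgroup.commutator_mem_commutator (Subgroup.mem_top _) (C.inv_mem hc)
  · intro q
    obtain ⟨⟨c, hc⟩, hcq⟩ := QuotientGroup.mk_surjective (Additive.toMul q)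
    exact ⟨c, hc, (dif_pos hc).trans (congrArg Additive.ofMul hcq)⟩
  · intro c hc h0
    have : (QuotientGroup.mk (s := K) ⟨c, hc⟩) = 1 := (dif_pos hc).symm.trans h0
    rwa [QuotientGroup.eq_one_iff, Subgroup.mem_subgroupOf] at this

theorem exists_invariantHom_ne_zero {p : ℕ} [Fact p.Prime] (C : Subgroup G) [C.Normal]
    (hp : ∀ c ∈ C, c ^ p ∈ ⁅C, (⊤ : Subgroup G)⁆) {c₀ : G} (hc₀ : c₀ ∈ C)
    (hc₀' : c₀ ∉ ⁅C, (⊤ : Subgroup G)⁆) :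
    ∃ θ : G → ZMod p, IsInvariantHom C θ ∧ θ c₀ ≠ 0 := by
  obtain ⟨Q, _, _, π, hπ, -, hk⟩ := exists_layer p C hp
  have h0 : π c₀ ≠ 0 := fun h => hc₀' (hk c₀ hc₀ h)
  obtain ⟨l, hl⟩ : ∃ l : Dual (ZMod p) Q, l (π c₀) ≠ 0 := by
    by_contra! hc
    exact h0 ((Module.forall_dual_apply_eq_zero_iff (ZMod p) _).1 hc)
  exact ⟨fun g => l (π g), ⟨fun a ha b hb => by rw [hπ.map_mul a ha b hb, map_add],
    fun g c hc => by rw [hπ.map_conj g c hc]⟩, hl⟩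

/-- The correction [c, [c^n, g]] in the expansion of [c^(n+1), g] lies in [C, G, G]. -/
theorem mk_commutator_pow (C : Subgroup G) [C.Normal] {c : G} (hc : c ∈ C) (g : G) (n : ℕ) :
    ((⁅c ^ n, g⁆ : G) : G ⧸ ⁅⁅C, (⊤ : Subgroup G)⁆, (⊤ : Subgroup G)⁆) = (⁅c, g⁆ : G) ^ n := by
  induction n with
  | zero => simp
  | succ n ih =>
    have e : ⁅c ^ (n + 1), g⁆ = ⁅c, ⁅c ^ n, g⁆⁆ * ⁅c ^ n, g⁆ * ⁅c, g⁆ := by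
      rw [pow_succ']
      simp [commutatorElement_def, mul_assoc]
    have h1 : ⁅c, ⁅c ^ n, g⁆⁆ ∈ ⁅⁅C, (⊤ : Subgroup G)⁆, (⊤ : Subgroup G)⁆ := by
      rw [Subgroup.commutator_comm]
      exact Subgroup.commutator_mem_commutator (Subgroup.mem_top _)
        (Subgroup.commutator_mem_commutator (C.pow_mem hc n) (Subgroup.mem_top _))
    rw [e, QuotientGroup.mk_mul, QuotientGroup.mk_mul, ih, (QuotientGroup.eq_one_iff _).2 h1,
      one_mul, pow_succ]

theorem mk_mul_comm (D : Subgroup G) [D.Normal] {a : G} (ha : a ∈ D) (b : G) :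
    ((a * b : G) : G ⧸ ⁅D, (⊤ : Subgroup G)⁆) = ((b * a : G) : G ⧸ ⁅D, (⊤ : Subgroup G)⁆) := by
  rw [QuotientGroup.eq]
  have e : (a * b)⁻¹ * (b * a) = ⁅b⁻¹, a⁻¹⁆ := by simp [commutatorElement_def, mul_assoc]
  rw [e, Subgroup.commutator_comm]
  exact Subgroup.commutator_mem_commutator (Subgroup.mem_top _) (D.inv_mem ha)

/-- Modulo [C, G, G] the subgroup [C, G] is central, so p-th powers are multiplicative on it, and on
generators [c, g]^p agrees with [c^p, g]. Exponent p thus passes down the lower central series. -/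
theorem pow_mem_commutator_of_pow_mem {p : ℕ} (C : Subgroup G) [C.Normal]
    (hp : ∀ c ∈ C, c ^ p ∈ ⁅C, (⊤ : Subgroup G)⁆) :
    ∀ d ∈ ⁅C, (⊤ : Subgroup G)⁆, d ^ p ∈ ⁅⁅C, (⊤ : Subgroup G)⁆, (⊤ : Subgroup G)⁆ := by
  let N : Subgroup G := ⁅⁅C, (⊤ : Subgroup G)⁆, (⊤ : Subgroup G)⁆
  let S : Subgroup G :=
    { carrier := {d | d ∈ ⁅C, (⊤ : Subgroup G)⁆ ∧ (d : G ⧸ N) ^ p = 1}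
      one_mem' := ⟨Subgroup.one_mem _, by simp⟩
      mul_mem' := fun {a b} ha hb => ⟨Subgroup.mul_mem _ ha.1 hb.1, by
        have hc : Commute (a : G ⧸ N) (b : G ⧸ N) := mk_mul_comm _ ha.1 b
        rw [QuotientGroup.mk_mul, hc.mul_pow, ha.2, hb.2, one_mul]⟩
      inv_mem' := fun {a} ha => ⟨Subgroup.inv_mem _ ha.1, by
        rw [QuotientGroup.mk_inv, inv_pow, ha.2, inv_one]⟩ }
  have hle : ⁅C, (⊤ : Subgroup G)⁆ ≤ S := by
    rw [Subgroup.commutator_le]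
    intro c hc g _
    refine ⟨Subgroup.commutator_mem_commutator hc (Subgroup.mem_top g), ?_⟩
    rw [← mk_commutator_pow C hc, QuotientGroup.eq_one_iff]
    exact Subgroup.commutator_mem_commutator (hp c hc) (Subgroup.mem_top g)
  intro d hd
  have := (hle hd).2
  rwa [← QuotientGroup.mk_pow, QuotientGroup.eq_one_iff] at this

theorem eq_bot_of_le_commutator_top [hG : Group.IsNilpotent G] (D : Subgroup G)
    (hD : D ≤ ⁅D, (⊤ : Subgroup G)⁆) : D = ⊥ := by
  obtain ⟨n, hn⟩ := Subgroup.nilpotent_iff_lowerCentralSeries.1 hG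
  have : ∀ n, D ≤ (⊤ : Subgroup G).lowerCentralSeries n := by
    intro n
    induction n with
    | zero => exact le_top
    | succ n ih => exact hD.trans (Subgroup.commutator_mono ih le_rfl)
  rw [eq_bot_iff, ← hn]
  exact this n

/-- Every element of `G'` is a commutator with any prescribed element outside of `G'`. -/
def HasFullCommutators (G : Type*) [Group G] : Prop :=
  ∀ x : G, x ∉ ⁅(⊤ : Subgroup G), (⊤ : Subgroup G)⁆ →
    ∀ d ∈ ⁅(⊤ : Subgroup G), (⊤ : Subgroup G)⁆, ∃ y, ⁅x, y⁆ = d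

/-- The element d⁻¹x lies in the coset xG', hence equals y x y⁻¹ for some y, and then [x, y] = d. -/
theorem IsCaminaGroup.hasFullCommutators (hG : IsCaminaGroup G) : HasFullCommutators G := by
  intro x hx d hd
  have hn : (commutator G).Normal := inferInstance
  have h1 : x⁻¹ * d⁻¹ * x ∈ commutator G := by
    simpa using hn.conj_mem _ ((commutator G).inv_mem hd) x⁻¹
  have h2 : x * (x⁻¹ * d⁻¹ * x) ∈ conjugatesOf x := by
    rw [← hG.2 x hx]
    exact ⟨_, h1, rfl⟩
  obtain ⟨y, hy⟩ := isConj_iff.1 (show IsConj x _ from h2)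
  refine ⟨y, ?_⟩
  have h3 : y * x * y⁻¹ = d⁻¹ * x := by rw [hy]; simp [mul_assoc]
  have h4 : ⁅x, y⁆ = (y * x * y⁻¹ * x⁻¹)⁻¹ := by simp [commutatorElement_def, mul_assoc]
  rw [h4, h3, mul_inv_cancel_right, inv_inv]

/-- In a Camina `p`-group the factor group `G/G'` has exponent `p`. -/
theorem HasFullCommutators.pow_mem {p : ℕ} (hG : HasFullCommutators G)
    [Group.IsNilpotent G] (hfin : ∃ k, ∀ g : G, g ^ p ^ k = 1)
    (hne : ⁅(⊤ : Subgroup G), (⊤ : Subgroup G)⁆ ≠ ⊥) (x : G) :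
    x ^ p ∈ ⁅(⊤ : Subgroup G), (⊤ : Subgroup G)⁆ := by
  by_contra hx
  apply hne
  apply eq_bot_of_le_commutator_top
  set D : Subgroup G := ⁅(⊤ : Subgroup G), (⊤ : Subgroup G)⁆ with hD
  -- If x^p is outside G', then d = [x^p, y] ≡ [x, y]^p; iterating past the exponent of G makes d
  -- trivial modulo [D, G].
  have key : ∀ d ∈ D, ∃ e ∈ D,
      (d : G ⧸ ⁅D, (⊤ : Subgroup G)⁆) = (e : G ⧸ ⁅D, (⊤ : Subgroup G)⁆) ^ p := by
    intro d hd
    obtain ⟨y, rfl⟩ := hG _ hx d hd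
    exact ⟨⁅x, y⁆, Subgroup.commutator_mem_commutator (Subgroup.mem_top x) (Subgroup.mem_top y),
      mk_commutator_pow ⊤ (Subgroup.mem_top x) y p⟩
  have key2 : ∀ k, ∀ d ∈ D, ∃ e ∈ D,
      (d : G ⧸ ⁅D, (⊤ : Subgroup G)⁆) = (e : G ⧸ ⁅D, (⊤ : Subgroup G)⁆) ^ p ^ k := by
    intro k
    induction k with
    | zero => exact fun d hd => ⟨d, hd, by simp⟩
    | succ k ih =>
      intro d hd
      obtain ⟨e, he, hde⟩ := ih d hd
      obtain ⟨e', he', hee'⟩ := key e he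
      exact ⟨e', he', by rw [hde, hee', ← pow_mul, pow_succ']⟩
  obtain ⟨k, hk⟩ := hfin
  intro d hd
  obtain ⟨e, -, hde⟩ := key2 k d hd
  rwa [← QuotientGroup.mk_pow, hk, QuotientGroup.mk_one, QuotientGroup.eq_one_iff] at hde

end Layers

/-! ### The first two factors, and class at most two for p = 2. -/

section LowerLayers

universe u

/-- The second term `[G, G]` of the lower central series. -/
abbrev secondTerm (G : Type*) [Group G] : Subgroup G := ⁅(⊤ : Subgroup G), (⊤ : Subgroup G)⁆

/-- The third term `[G, G, G]` of the lower central series. -/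
abbrev thirdTerm (G : Type*) [Group G] : Subgroup G := ⁅secondTerm G, (⊤ : Subgroup G)⁆

/-- The fourth term `[G, G, G, G]` of the lower central series. -/
abbrev fourthTerm (G : Type*) [Group G] : Subgroup G := ⁅thirdTerm G, (⊤ : Subgroup G)⁆

variable {G : Type u} [Group G]

theorem commutator_mem_secondTerm (x y : G) : ⁅x, y⁆ ∈ secondTerm G :=
  Subgroup.commutator_mem_commutator (Subgroup.mem_top x) (Subgroup.mem_top y)

theorem commutator_mem_thirdTerm {w : G} (hw : w ∈ secondTerm G) (x : G) : ⁅w, x⁆ ∈ thirdTerm G :=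
  Subgroup.commutator_mem_commutator hw (Subgroup.mem_top x)

theorem commutator_mem_fourthTerm {w : G} (hw : w ∈ thirdTerm G) (x : G) : ⁅w, x⁆ ∈ fourthTerm G :=
  Subgroup.commutator_mem_commutator hw (Subgroup.mem_top x)

theorem commutator_mem_fourthTerm_of_mem_second {w w' : G} (hw : w ∈ secondTerm G)
    (hw' : w' ∈ secondTerm G) : ⁅w, w'⁆ ∈ fourthTerm G :=
  commutator_top_top_le (secondTerm G) (Subgroup.commutator_mem_commutator hw hw')

theorem commutator_mem_of_mem_second_of_mem_third {w w' : G} (hw : w ∈ secondTerm G)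
    (hw' : w' ∈ thirdTerm G) : ⁅w, w'⁆ ∈ ⁅fourthTerm G, (⊤ : Subgroup G)⁆ :=
  commutator_top_top_le (thirdTerm G) (Subgroup.commutator_mem_commutator hw hw')

theorem commutator_mem_of_mem_third_of_mem_second {w w' : G} (hw : w ∈ thirdTerm G)
    (hw' : w' ∈ secondTerm G) : ⁅w, w'⁆ ∈ ⁅fourthTerm G, (⊤ : Subgroup G)⁆ := by
  rw [← commutatorElement_inv]
  exact Subgroup.inv_mem _ (commutator_mem_of_mem_second_of_mem_third hw' hw)

theorem IsInvariantHom.eq_zero_of_commutator {A : Type*} [AddCommGroup A] {D : Subgroup G}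
    {θ : G → A} (hθ : IsInvariantHom ⁅D, (⊤ : Subgroup G)⁆ θ) (h : ∀ w ∈ D, ∀ x, θ ⁅w, x⁆ = 0)
    {c : G} (hc : c ∈ ⁅D, (⊤ : Subgroup G)⁆) : θ c = 0 := by
  let K : Subgroup G :=
    { carrier := {c | c ∈ ⁅D, (⊤ : Subgroup G)⁆ ∧ θ c = 0}
      one_mem' := ⟨Subgroup.one_mem _, hθ.map_one⟩
      mul_mem' := fun {a b} ha hb => ⟨Subgroup.mul_mem _ ha.1 hb.1, by
        rw [hθ.map_mul _ ha.1 _ hb.1, ha.2, hb.2, add_zero]⟩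
      inv_mem' := fun {a} ha => ⟨Subgroup.inv_mem _ ha.1, by rw [hθ.map_inv ha.1, ha.2, neg_zero]⟩ }
  have hle : ⁅D, (⊤ : Subgroup G)⁆ ≤ K := by
    rw [Subgroup.commutator_le]
    exact fun w hw x _ =>
      ⟨Subgroup.commutator_mem_commutator hw (Subgroup.mem_top x), h w hw x⟩
  exact (hle hc).2

/-- The maps of `G` onto `G/[G, G]` and of `[G, G]` onto `[G, G]/[G, G, G]`. -/
structure IsLowerLayers {V W : Type*} [AddCommGroup V] [AddCommGroup W]
    (πV : G → V) (πW : G → W) : Prop where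
  homV : IsInvariantHom (⊤ : Subgroup G) πV
  surjV : ∀ v, ∃ x ∈ (⊤ : Subgroup G), πV x = v
  kerV : ∀ x ∈ (⊤ : Subgroup G), πV x = 0 → x ∈ secondTerm G
  homW : IsInvariantHom (secondTerm G) πW
  surjW : ∀ w, ∃ x ∈ secondTerm G, πW x = w
  kerW : ∀ x ∈ secondTerm G, πW x = 0 → x ∈ thirdTerm G

theorem exists_isLowerLayers {p : ℕ} (hp : ∀ x : G, x ^ p ∈ secondTerm G) :
    ∃ (V W : Type u) (_ : AddCommGroup V) (_ : Module (ZMod p) V) (_ : AddCommGroup W)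
      (_ : Module (ZMod p) W) (πV : G → V) (πW : G → W), IsLowerLayers πV πW := by
  have hp' : ∀ c ∈ (⊤ : Subgroup G), c ^ p ∈ ⁅(⊤ : Subgroup G), (⊤ : Subgroup G)⁆ := fun c _ => hp c
  obtain ⟨V, i1, i2, πV, a1, a2, a3⟩ := exists_layer p (⊤ : Subgroup G) hp'
  obtain ⟨W, i3, i4, πW, b1, b2, b3⟩ :=
    exists_layer p (secondTerm G) (pow_mem_commutator_of_pow_mem ⊤ hp')
  exact ⟨V, W, i1, i2, i3, i4, πV, πW, a1, a2, a3, b1, b2, b3⟩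

namespace IsLowerLayers

variable {p : ℕ} {V W : Type*} [AddCommGroup V] [AddCommGroup W] [Module (ZMod p) V]
  [Module (ZMod p) W] {πV : G → V} {πW : G → W}

theorem finite_left [Finite G] (h : IsLowerLayers πV πW) : Finite V :=
  Finite.of_surjective πV fun v => (h.surjV v).imp fun _ hx => hx.2

theorem finite_right [Finite G] (h : IsLowerLayers πV πW) : Finite W :=
  Finite.of_surjective πW fun v => (h.surjW v).imp fun _ hx => hx.2

theorem apply_mul (h : IsLowerLayers πV πW) (x y : G) : πV (x * y) = πV x + πV y :=
  h.homV.map_mul x (Subgroup.mem_top x) y (Subgroup.mem_top y)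

theorem apply_eq_zero_iff (h : IsLowerLayers πV πW) {x : G} : πV x = 0 ↔ x ∈ secondTerm G :=
  ⟨h.kerV x (Subgroup.mem_top x), h.homV.map_commutator_eq_zero⟩

theorem inv_mul_mem_of_apply_eq (h : IsLowerLayers πV πW) {x y : G} (hxy : πV x = πV y) :
    x⁻¹ * y ∈ secondTerm G := by
  rw [← h.apply_eq_zero_iff, h.apply_mul, h.homV.map_inv (Subgroup.mem_top x), hxy, neg_add_cancel]

theorem exists_bracket (h : IsLowerLayers πV πW) :
    ∃ br : V →ₗ[ZMod p] V →ₗ[ZMod p] W, (∀ x y, br (πV x) (πV y) = πW ⁅x, y⁆) ∧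
      (∀ x, br x x = 0) ∧
      (HasFullCommutators G → ∀ x, x ≠ 0 → Function.Surjective (br x)) := by
  obtain ⟨br, hbr⟩ := (h.homV.isCover h.surjV).exists_bilinear (p := p) (h.homV.isCover h.surjV)
    (fun x y => πW ⁅x, y⁆)
    (fun a _ b _ c _ => h.homW.commutator_mul_left (commutator_mem_secondTerm _ _)
      (commutator_mem_secondTerm _ _))
    (fun a _ b _ c _ => h.homW.commutator_mul_right (commutator_mem_secondTerm _ _)
      (commutator_mem_secondTerm _ _))
    (fun a ha b _ ha0 => h.homW.map_commutator_eq_zero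
      (commutator_mem_thirdTerm (h.kerV a ha ha0) b))
    (fun a _ b hb hb0 => by
      rw [h.homW.commutator_swap (commutator_mem_secondTerm b a), neg_eq_zero]
      exact h.homW.map_commutator_eq_zero (commutator_mem_thirdTerm (h.kerV b hb hb0) a))
  have hbr' : ∀ x y, br (πV x) (πV y) = πW ⁅x, y⁆ :=
    fun x y => hbr x (Subgroup.mem_top x) y (Subgroup.mem_top y)
  refine ⟨br, hbr', fun v => ?_, fun hG v hv w => ?_⟩
  · obtain ⟨x, -, rfl⟩ := h.surjV v
    rw [hbr', commutatorElement_self, h.homW.map_one]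
  · obtain ⟨x, -, rfl⟩ := h.surjV v
    obtain ⟨d, hd, rfl⟩ := h.surjW w
    obtain ⟨y, rfl⟩ := hG x (fun hx => hv (h.apply_eq_zero_iff.2 hx)) d hd
    exact ⟨πV y, hbr' x y⟩

theorem isJacobi [Fact p.Prime] (h : IsLowerLayers πV πW) {θ : G → ZMod p}
    (hθ : IsInvariantHom (thirdTerm G) θ) {f : W →ₗ[ZMod p] V →ₗ[ZMod p] ZMod p}
    (hf : ∀ w ∈ secondTerm G, ∀ x, f (πW w) (πV x) = θ ⁅w, x⁆)
    {br : V →ₗ[ZMod p] V →ₗ[ZMod p] W} (hbr : ∀ x y, br (πV x) (πV y) = πW ⁅x, y⁆) :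
    IsJacobi br f := by
  intro x y z
  obtain ⟨x, -, rfl⟩ := h.surjV x
  obtain ⟨y, -, rfl⟩ := h.surjV y
  obtain ⟨z, -, rfl⟩ := h.surjV z
  rw [hbr, hbr, hbr, hf _ (commutator_mem_secondTerm _ _), hf _ (commutator_mem_secondTerm _ _),
    hf _ (commutator_mem_secondTerm _ _)]
  exact hθ.jacobi (commutator_mem_thirdTerm (commutator_mem_secondTerm _ _) _)
    (commutator_mem_thirdTerm (commutator_mem_secondTerm _ _) _)
    (commutator_mem_thirdTerm (commutator_mem_secondTerm _ _) _)
    (commutator_mem_fourthTerm_of_mem_second (commutator_mem_secondTerm _ _)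
      (commutator_mem_secondTerm _ _))
    (commutator_mem_fourthTerm_of_mem_second (commutator_mem_secondTerm _ _)
      (commutator_mem_secondTerm _ _))
    (commutator_mem_fourthTerm_of_mem_second (commutator_mem_secondTerm _ _)
      (commutator_mem_secondTerm _ _))

theorem exists_tripleBracket [Fact p.Prime] (h : IsLowerLayers πV πW) {θ : G → ZMod p}
    (hθ : IsInvariantHom (thirdTerm G) θ) :
    ∃ f : W →ₗ[ZMod p] V →ₗ[ZMod p] ZMod p,
      (∀ w ∈ secondTerm G, ∀ x, f (πW w) (πV x) = θ ⁅w, x⁆) ∧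
      ∀ br : V →ₗ[ZMod p] V →ₗ[ZMod p] W, (∀ x y, br (πV x) (πV y) = πW ⁅x, y⁆) →
        IsJacobi br f := by
  obtain ⟨f, hf⟩ := (h.homW.isCover h.surjW).exists_bilinear (p := p) (h.homV.isCover h.surjV)
    (fun x y => θ ⁅x, y⁆)
    (fun a ha b hb c _ => hθ.commutator_mul_left (commutator_mem_thirdTerm ha c)
      (commutator_mem_thirdTerm hb c))
    (fun a ha b _ c _ => hθ.commutator_mul_right (commutator_mem_thirdTerm ha b)
      (commutator_mem_thirdTerm ha c))
    (fun a ha b _ ha0 => hθ.map_commutator_eq_zero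
      (commutator_mem_fourthTerm (h.kerW a ha ha0) b))
    (fun a ha b hb hb0 => hθ.map_commutator_eq_zero
      (commutator_mem_fourthTerm_of_mem_second ha (h.kerV b hb hb0)))
  have hf' : ∀ w ∈ secondTerm G, ∀ x, f (πW w) (πV x) = θ ⁅w, x⁆ :=
    fun w hw x => hf w hw x (Subgroup.mem_top x)
  exact ⟨f, hf', fun br hbr => h.isJacobi hθ hf' hbr⟩

theorem finrank_left_pos [Finite G] [Fact p.Prime] (h : IsLowerLayers πV πW)
    (hne : secondTerm G ≠ ⊤) : 0 < finrank (ZMod p) V := by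
  have := h.finite_left
  rw [Module.finrank_pos_iff_exists_ne_zero]
  by_contra! hc
  exact hne (eq_top_iff.2 fun x _ => h.apply_eq_zero_iff.1 (hc _))

end IsLowerLayers

theorem secondTerm_ne_top [Group.IsNilpotent G] (hne : secondTerm G ≠ ⊥) : secondTerm G ≠ ⊤ := by
  intro htop
  apply hne
  apply eq_bot_of_le_commutator_top
  rw [htop]
  exact htop.ge

/-- A Camina `2`-group is of class at most two. -/
theorem thirdTerm_eq_bot_of_two [Finite G] [Group.IsNilpotent G] (hG : HasFullCommutators G)
    (hp : ∀ x : G, x ^ 2 ∈ secondTerm G) : thirdTerm G = ⊥ := by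
  by_contra hne
  have hne2 : secondTerm G ≠ ⊥ := by
    intro h
    apply hne
    rw [thirdTerm, h, Subgroup.commutator_bot_left]
  have hp1 : ∀ c ∈ (⊤ : Subgroup G), c ^ 2 ∈ secondTerm G := fun c _ => hp c
  have hp2 := pow_mem_commutator_of_pow_mem ⊤ hp1
  have hp3 := pow_mem_commutator_of_pow_mem _ hp2
  obtain ⟨c₀, hc₀, hc₀'⟩ : ∃ c ∈ thirdTerm G, c ∉ fourthTerm G := by
    by_contra! hc
    exact hne (eq_bot_of_le_commutator_top _ hc)
  obtain ⟨θ, hθ, hθ0⟩ := exists_invariantHom_ne_zero (p := 2) (thirdTerm G) hp3 hc₀ hc₀'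
  obtain ⟨V, W, _, _, _, _, πV, πW, h⟩ := exists_isLowerLayers hp
  have := h.finite_left
  have := h.finite_right
  obtain ⟨br, hbr, halt, hsurj⟩ := h.exists_bracket (p := 2)
  obtain ⟨f, hf, hj⟩ := h.exists_tripleBracket hθ
  have hsq : ∀ x y : G, πW ((x * y) ^ 2) = πW (x ^ 2) + πW (y ^ 2) + πW ⁅x, y⁆ := by
    intro x y
    have e : (x * y) ^ 2 = (x * ⁅y, x⁆ * x⁻¹) * (x ^ 2 * y ^ 2) := by
      simp [commutatorElement_def, mul_assoc, pow_two]
    have hn : (secondTerm G).Normal := inferInstance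
    rw [e, h.homW.map_mul _ (hn.conj_mem _ (commutator_mem_secondTerm _ _) _) _
      (Subgroup.mul_mem _ (hp x) (hp y)), h.homW.map_conj _ _ (commutator_mem_secondTerm _ _),
      h.homW.map_mul _ (hp x) _ (hp y), h.homW.commutator_swap (commutator_mem_secondTerm x y),
      ZModModule.neg_eq_self, add_comm]
  have hsqW : ∀ d ∈ secondTerm G, πW (d ^ 2) = 0 := fun d hd =>
    h.homW.map_commutator_eq_zero (hp2 d hd)
  choose sec hsec using h.surjV
  -- Squaring descends to a map V → W, independent of the representative: changing x by d ∈ G'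
  -- changes x² by d² and [x, d], both in the third term.
  have hq : ∀ x, πW (sec (πV x) ^ 2) = πW (x ^ 2) := by
    intro x
    have hd := h.inv_mul_mem_of_apply_eq (hsec (πV x)).2.symm
    have e : sec (πV x) = x * (x⁻¹ * sec (πV x)) := by group
    rw [e, hsq, hsqW _ hd, ← hbr, h.apply_eq_zero_iff.2 hd, map_zero, add_zero, add_zero]
  have hb : IsCaminaBracket br := by
    refine isCaminaBracket_of_two (h.finrank_left_pos (secondTerm_ne_top hne2)) br halt (hsurj hG)
      (fun v => πW (sec v ^ 2)) fun v v' => ?_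
    obtain ⟨x, -, rfl⟩ := h.surjV v
    obtain ⟨y, -, rfl⟩ := h.surjV v'
    rw [← h.apply_mul, hq, hq, hq, hsq, hbr]
  -- Squaring on G' followed by θ: additive because θ kills the fourth term, and zero on the third
  -- term because 2 = 0.
  obtain ⟨s, hs⟩ := (h.homW.isCover h.surjW).exists_linear (p := 2) (fun w => θ (w ^ 2))
    (fun a ha b hb => by
      have e : (a * b) ^ 2 = (a * ⁅b, a⁆ * a⁻¹) * (a ^ 2 * b ^ 2) := by
        simp [commutatorElement_def, mul_assoc, pow_two]
      have h4 := commutator_mem_fourthTerm_of_mem_second hb ha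
      have h3 := Subgroup.commutator_le_left _ _ h4
      have hn : (thirdTerm G).Normal := inferInstance
      rw [e, hθ.map_mul _ (hn.conj_mem _ h3 _) _ (Subgroup.mul_mem _ (hp2 a ha) (hp2 b hb)),
        hθ.map_conj _ _ h3, hθ.map_commutator_eq_zero h4, hθ.map_mul _ (hp2 a ha) _ (hp2 b hb),
        zero_add])
    (fun a ha ha0 => by
      rw [hθ.map_pow (h.kerW a ha ha0), two_smul, CharTwo.add_self_eq_zero])
  have hf0 : f = 0 := by
    refine tripleBracket_eq_zero_of_two hb (hj br hbr) (fun v => πW (sec v ^ 2)) s ?_ ?_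
    · intro v v'
      obtain ⟨x, -, rfl⟩ := h.surjV v
      obtain ⟨y, -, rfl⟩ := h.surjV v'
      have hc := commutator_mem_secondTerm x y
      -- Applying θ to this identity is the compatibility relation between q, s and f.
      have e : ⁅x ^ 2, y⁆ = ⁅x, ⁅x, y⁆⁆ * ⁅x, y⁆ ^ 2 := by
        simp [commutatorElement_def, mul_assoc, pow_two]
      have h3 := commutator_mem_thirdTerm hc x
      have h3' : ⁅x, ⁅x, y⁆⁆ ∈ thirdTerm G := by
        rw [← commutatorElement_inv]
        exact Subgroup.inv_mem _ h3
      rw [hq, hf _ (hp x), hbr, hs _ hc, hf _ hc, e, hθ.map_mul _ h3' _ (hp2 _ hc),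
        hθ.commutator_swap h3, CharTwo.neg_eq, add_comm]
    · intro v hv hv0
      obtain ⟨a, -, rfl⟩ := h.surjV v
      -- Choose [a, y] = c₀ with θ(c₀) ≠ 0. Since θ kills [a, G'], such a y is neither in G' nor in
      -- aG', yet it commutes with a modulo the third term.
      obtain ⟨y, hy⟩ := hG a (fun ha => hv0 (h.apply_eq_zero_iff.2 ha)) c₀
        (Subgroup.commutator_le_left _ _ hc₀)
      have hzero : ∀ d ∈ secondTerm G, θ ⁅a, d⁆ = 0 := by
        intro d hd
        rw [hθ.commutator_swap (commutator_mem_thirdTerm hd a), neg_eq_zero, ← hf d hd]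
        exact LinearMap.congr_fun (LinearMap.mem_ker.1 hv) _
      refine ⟨πV y, ?_, fun hy0 => ?_, fun hya => ?_⟩
      · rw [hbr, hy]
        exact h.homW.map_commutator_eq_zero hc₀
      · apply hθ0
        rw [← hy]
        exact hzero y (h.apply_eq_zero_iff.1 hy0)
      · apply hθ0
        have hd := h.inv_mul_mem_of_apply_eq hya.symm
        have e : y = a * (a⁻¹ * y) := by group
        have h3 : ⁅a, a⁻¹ * y⁆ ∈ thirdTerm G := by
          rw [← commutatorElement_inv]
          exact Subgroup.inv_mem _ (commutator_mem_thirdTerm hd a)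
        rw [← hy, e, hθ.commutator_mul_right (by simp) h3, hzero _ hd, commutatorElement_self,
          hθ.map_one, add_zero]
  exact hθ0 (hθ.eq_zero_of_commutator (fun w hw x => by rw [← hf w hw, hf0]; rfl) hc₀)

end LowerLayers

/-! ### Class at most three for p = 3. -/

section ClassThree

universe u

variable {G : Type u} [Group G]

theorem commutator_mem_thirdTerm_right (x : G) {w : G} (hw : w ∈ secondTerm G) :
    ⁅x, w⁆ ∈ thirdTerm G := by
  rw [← commutatorElement_inv]
  exact Subgroup.inv_mem _ (commutator_mem_thirdTerm hw x)

theorem thirdTerm_le_secondTerm (G : Type*) [Group G] : thirdTerm G ≤ secondTerm G :=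
  Subgroup.commutator_le_left _ _

namespace IsLowerLayers

variable {p : ℕ} {V W : Type*} [AddCommGroup V] [AddCommGroup W] [Module (ZMod p) V]
  [Module (ZMod p) W] {πV : G → V} {πW : G → W}

theorem exists_cover_submodule (h : IsLowerLayers πV πW) (A : Submodule (ZMod p) V) :
    ∃ (C : Subgroup G) (π : G → A), IsCover C π ∧ (∀ g, g ∈ C ↔ πV g ∈ A) ∧
      ∀ g ∈ C, (π g : V) = πV g := by
  classical
  let C : Subgroup G :=
    { carrier := {g | πV g ∈ A}
      one_mem' := by simp [h.homV.map_one]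
      mul_mem' := fun {a b} ha hb => by
        simpa [h.apply_mul] using A.add_mem ha hb
      inv_mem' := fun {a} ha => by
        simpa [h.homV.map_inv (Subgroup.mem_top a)] using ha }
  let π : G → A := fun g => if hg : πV g ∈ A then ⟨πV g, hg⟩ else 0
  have hπ : ∀ g ∈ C, (π g : V) = πV g := fun g hg => by
    simp only [π]
    rw [dif_pos (show πV g ∈ A from hg)]
  refine ⟨C, π, ⟨fun a ha b hb => ?_, fun q => ?_⟩, fun g => Iff.rfl, hπ⟩
  · ext
    rw [Submodule.coe_add, hπ _ ha, hπ _ hb, hπ _ (C.mul_mem ha hb), h.apply_mul]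
  · obtain ⟨x, -, hx⟩ := h.surjV q
    have hxC : x ∈ C := show πV x ∈ A from hx ▸ q.2
    exact ⟨x, hxC, Subtype.ext ((hπ x hxC).trans hx)⟩

/-- Well defined because [γ₂, γ₂] ≤ γ₄, [γ₂, γ₃] ≤ γ₅ and θ kills γ₅. The relation between Φ and β
is the Jacobi identity for w, x, v. -/
theorem exists_fourfoldBracket [Fact p.Prime] (h : IsLowerLayers πV πW) {θ : G → ZMod p}
    (hθ : IsInvariantHom (fourthTerm G) θ) {br : V →ₗ[ZMod p] V →ₗ[ZMod p] W}
    (hbr : ∀ x y, br (πV x) (πV y) = πW ⁅x, y⁆) :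
    ∃ (Φ : V →ₗ[ZMod p] W →ₗ[ZMod p] V →ₗ[ZMod p] ZMod p)
      (β : W →ₗ[ZMod p] W →ₗ[ZMod p] ZMod p),
      (∀ v, ∀ w ∈ secondTerm G, ∀ x, Φ (πV v) (πW w) (πV x) = θ ⁅⁅w, x⁆, v⁆) ∧
      (∀ v, IsJacobi br (Φ v)) ∧ (∀ w, β w w = 0) ∧
      ∀ w x v, Φ v w x - Φ x w v = β w (br x v) := by
  have hv : ∀ v, IsInvariantHom (thirdTerm G) fun d => θ ⁅d, v⁆ :=
    fun v => hθ.commutator_left le_rfl v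
  obtain ⟨Φ, hΦ⟩ := (h.homV.isCover h.surjV).exists_trilinear (p := p)
    (h.homW.isCover h.surjW) (h.homV.isCover h.surjV) (fun v w x => θ ⁅⁅w, x⁆, v⁆)
    (fun a _ b _ c hc d _ => hθ.commutator_mul_right
      (commutator_mem_fourthTerm (commutator_mem_thirdTerm hc d) a)
      (commutator_mem_fourthTerm (commutator_mem_thirdTerm hc d) b))
    (fun a _ b hb c hc d _ => (hv a).commutator_mul_left (commutator_mem_thirdTerm hb d)
      (commutator_mem_thirdTerm hc d))
    (fun a _ b hb c _ d _ => (hv a).commutator_mul_right (commutator_mem_thirdTerm hb c)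
      (commutator_mem_thirdTerm hb d))
    (fun a ha b hb c _ ha0 => hθ.map_commutator_eq_zero
      (commutator_mem_of_mem_third_of_mem_second (commutator_mem_thirdTerm hb c) (h.kerV a ha ha0)))
    (fun a _ b hb c _ hb0 => (hv a).map_commutator_eq_zero
      (commutator_mem_fourthTerm (h.kerW b hb hb0) c))
    (fun a _ b hb c hc hc0 => (hv a).map_commutator_eq_zero
      (commutator_mem_fourthTerm_of_mem_second hb (h.kerV c hc hc0)))
  have hΦ' : ∀ v, ∀ w ∈ secondTerm G, ∀ x, Φ (πV v) (πW w) (πV x) = θ ⁅⁅w, x⁆, v⁆ :=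
    fun v w hw x => hΦ v (Subgroup.mem_top v) w hw x (Subgroup.mem_top x)
  have mem4 := @commutator_mem_fourthTerm_of_mem_second G _
  obtain ⟨β, hβ⟩ := (h.homW.isCover h.surjW).exists_bilinear (p := p) (h.homW.isCover h.surjW)
    (fun w w' => θ ⁅w, w'⁆)
    (fun a ha b hb c hc => hθ.commutator_mul_left (mem4 ha hc) (mem4 hb hc))
    (fun a ha b hb c hc => hθ.commutator_mul_right (mem4 ha hb) (mem4 ha hc))
    (fun a ha b hb ha0 => hθ.map_commutator_eq_zero
      (commutator_mem_of_mem_third_of_mem_second (h.kerW a ha ha0) hb))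
    (fun a ha b hb hb0 => hθ.map_commutator_eq_zero
      (commutator_mem_of_mem_second_of_mem_third ha (h.kerW b hb hb0)))
  refine ⟨Φ, β, hΦ', fun v => ?_, fun w => ?_, fun w x v => ?_⟩
  · obtain ⟨v, -, rfl⟩ := h.surjV v
    exact h.isJacobi (hv v) (hΦ' v) hbr
  · obtain ⟨w, hw, rfl⟩ := h.surjW w
    rw [hβ w hw w hw, commutatorElement_self, hθ.map_one]
  · obtain ⟨w, hw, rfl⟩ := h.surjW w
    obtain ⟨x, -, rfl⟩ := h.surjV x
    obtain ⟨v, -, rfl⟩ := h.surjV v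
    have hxv := commutator_mem_secondTerm x v
    have hwx := commutator_mem_thirdTerm hw x
    have hwv := commutator_mem_thirdTerm hw v
    have hvw := commutator_mem_thirdTerm_right v hw
    have hle := thirdTerm_le_secondTerm G
    have hj := hθ.jacobi (commutator_mem_fourthTerm hwx v) (mem4 hxv hw)
      (commutator_mem_fourthTerm hvw x) (commutator_mem_of_mem_third_of_mem_second hwx hxv)
      (commutator_mem_of_mem_second_of_mem_third hxv hvw)
      (commutator_mem_of_mem_second_of_mem_third (hle hvw) hwx)
    have e : θ ⁅⁅v, w⁆, x⁆ = -θ ⁅⁅w, v⁆, x⁆ := (hv x).commutator_swap hwv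
    rw [e, hθ.commutator_swap (mem4 hw hxv)] at hj
    rw [hΦ' _ _ hw, hΦ' _ _ hw, hbr, hβ _ hw _ hxv]
    linear_combination hj

/-- On A = `ker (br x)`, the brackets [a, a'] already lie in the third term, so (a, a') ↦ θ[a, a',
l] is an alternating form for each l in a complement of `ker Φ` inside `cokernelAt Φ x`. The Camina
condition makes these forms nondegenerate, and the Chevalley-Warning bound with dim A = dim W
finishes. -/
theorem two_mul_finrank_cokernelAt_le [Finite G] {V W : Type*} [AddCommGroup V] [AddCommGroup W]
    [Module (ZMod 3) V] [Module (ZMod 3) W] [FiniteDimensional (ZMod 3) V]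
    [FiniteDimensional (ZMod 3) W] {πV : G → V} {πW : G → W} (h : IsLowerLayers πV πW)
    (hG : HasFullCommutators G) {θ : G → ZMod 3} (hθ : IsInvariantHom (fourthTerm G) θ)
    {br : V →ₗ[ZMod 3] V →ₗ[ZMod 3] W} (hbr : ∀ x y, br (πV x) (πV y) = πW ⁅x, y⁆)
    (hb : IsCaminaBracket br) {Φ : V →ₗ[ZMod 3] W →ₗ[ZMod 3] V →ₗ[ZMod 3] ZMod 3}
    (hΦ : ∀ v, ∀ w ∈ secondTerm G, ∀ x, Φ (πV v) (πW w) (πV x) = θ ⁅⁅w, x⁆, v⁆)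
    (hj : ∀ v, IsJacobi br (Φ v)) {x v₀ : V} (hx : x ≠ 0) (hv₀ : v₀ ∈ cokernelAt Φ x)
    (hv₀' : v₀ ∉ LinearMap.ker Φ) :
    2 * finrank (ZMod 3) (cokernelAt Φ x) ≤
      finrank (ZMod 3) W + 2 * finrank (ZMod 3) (LinearMap.ker Φ) := by
  have hv : ∀ v, IsInvariantHom (thirdTerm G) fun d => θ ⁅d, v⁆ :=
    fun v => hθ.commutator_left le_rfl v
  have hmem : ∀ {v}, v ∈ cokernelAt Φ x → x ∈ LinearMap.ker (Φ v).flip := fun hv =>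
    LinearMap.mem_ker.2 (LinearMap.ext (mem_cokernelAt.1 hv))
  have hA : ∀ {v}, v ∈ cokernelAt Φ x → v ∉ LinearMap.ker Φ →
      LinearMap.ker (br x) = LinearMap.ker (Φ v).flip :=
    fun hv hv' => hb.ker_eq (hj _) (fun h0 => hv' (LinearMap.mem_ker.2 h0)) (hmem hv) hx
  have hΦ₀ : Φ v₀ ≠ 0 := fun h0 => hv₀' (LinearMap.mem_ker.2 h0)
  have hzero : ∀ l ∈ cokernelAt Φ x, ∀ w, ∀ a ∈ LinearMap.ker (br x), Φ l w a = 0 := by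
    intro l hl w a ha
    by_cases hl' : l ∈ LinearMap.ker Φ
    · rw [LinearMap.mem_ker.1 hl']; rfl
    · rw [hA hl hl'] at ha
      exact LinearMap.congr_fun (LinearMap.mem_ker.1 ha) w
  have hAW : finrank (ZMod 3) (LinearMap.ker (br x)) = finrank (ZMod 3) W := by
    rw [hA hv₀ hv₀']
    exact (hb.finrank_data (hj v₀) hΦ₀).2
  obtain ⟨Q, hQ⟩ := Submodule.exists_isCompl (LinearMap.ker Φ)
  have hdim : finrank (ZMod 3) (cokernelAt Φ x) ≤
      finrank (ZMod 3) (Q ⊓ cokernelAt Φ x : Submodule (ZMod 3) V) +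
        finrank (ZMod 3) (LinearMap.ker Φ) := by
    have e : cokernelAt Φ x = LinearMap.ker Φ ⊔ Q ⊓ cokernelAt Φ x := by
      rw [← sup_inf_assoc_of_le _ (ker_le_cokernelAt Φ x), hQ.sup_eq_top, top_inf_eq]
    have := Submodule.finrank_add_le_finrank_add_finrank (LinearMap.ker Φ) (Q ⊓ cokernelAt Φ x)
    rw [← e] at this
    omega
  obtain ⟨CL, πL, hL, hLm, hLπ⟩ := h.exists_cover_submodule (Q ⊓ cokernelAt Φ x)
  obtain ⟨CA, πA, hA', hAm, hAπ⟩ := h.exists_cover_submodule (LinearMap.ker (br x))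
  have hthird : ∀ g ∈ CA, ∀ k ∈ CA, ⁅g, k⁆ ∈ thirdTerm G := by
    intro g hg k hk
    apply h.kerW _ (commutator_mem_secondTerm g k)
    rw [← hbr]
    apply hb.bracket_eq_zero (hj v₀) hΦ₀
    · rw [← hA hv₀ hv₀']; exact (hAm g).1 hg
    · rw [← hA hv₀ hv₀']; exact (hAm k).1 hk
  -- This makes the form depend only on classes modulo G': moving a or a' by an element of G' does
  -- not change it.
  have hcross : ∀ l ∈ CL, ∀ g ∈ secondTerm G, ∀ k ∈ CA, θ ⁅⁅g, k⁆, l⁆ = 0 := by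
    intro l hl g hg k hk
    rw [← hΦ l g hg k]
    exact hzero _ ((hLm l).1 hl).2 _ _ ((hAm k).1 hk)
  have hAsec : ∀ g ∈ CA, πA g = 0 → g ∈ secondTerm G := fun g hg h0 => by
    rw [← h.apply_eq_zero_iff, ← hAπ g hg, h0, Submodule.coe_zero]
  obtain ⟨ψ, hψ⟩ := hL.exists_trilinear (p := 3) hA' hA' (fun l g k => θ ⁅⁅g, k⁆, l⁆)
    (fun a _ b _ c hc d hd => hθ.commutator_mul_right
      (commutator_mem_fourthTerm (hthird c hc d hd) a)
      (commutator_mem_fourthTerm (hthird c hc d hd) b))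
    (fun a _ b hb c hc d hd => (hv a).commutator_mul_left (hthird b hb d hd) (hthird c hc d hd))
    (fun a _ b hb c hc d hd => (hv a).commutator_mul_right (hthird b hb c hc) (hthird b hb d hd))
    (fun a ha b hb c hc ha0 => hθ.map_commutator_eq_zero
      (commutator_mem_of_mem_third_of_mem_second (hthird b hb c hc) (by
        rw [← h.apply_eq_zero_iff, ← hLπ a ha, ha0, Submodule.coe_zero])))
    (fun a ha b hb c hc hb0 => hcross a ha b (hAsec b hb hb0) c hc)
    (fun a ha b hb c hc hc0 => by
      have := (hv a).commutator_swap (hthird c hc b hb)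
      rw [this, neg_eq_zero]
      exact hcross a ha c (hAsec c hc hc0) b hb)
  have := two_mul_finrank_le_of_alternating_family
    (by rw [hAW]; exact IsCaminaBracket.finrank_pos hΦ₀) ψ ?_ ?_
  · omega
  · intro l a
    obtain ⟨l, hl, rfl⟩ := hL.surj l
    obtain ⟨a, ha, rfl⟩ := hA'.surj a
    rw [hψ l hl a ha a ha, commutatorElement_self, (hv l).map_one]
  · intro l a hl0 ha0
    obtain ⟨l, hl, rfl⟩ := hL.surj l
    obtain ⟨a, ha, rfl⟩ := hA'.surj a
    obtain ⟨w, hw, y, hwy⟩ : ∃ w ∈ secondTerm G, ∃ y, θ ⁅⁅w, y⁆, l⁆ ≠ 0 := by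
      by_contra! hc
      apply hl0
      ext
      rw [Submodule.coe_zero, hLπ l hl, ← Submodule.mem_bot (ZMod 3), ← hQ.inf_eq_bot]
      refine ⟨LinearMap.mem_ker.2 ?_, ((hLm l).1 hl).1⟩
      ext w y
      obtain ⟨w, hw, rfl⟩ := h.surjW w
      obtain ⟨y, -, rfl⟩ := h.surjV y
      rw [hΦ l w hw y, hc w hw y]; rfl
    have hτ := commutator_mem_thirdTerm hw y
    have ha1 : πV a ≠ 0 := fun h0 => ha0 (Subtype.ext (by rw [hAπ a ha, h0, Submodule.coe_zero]))
    obtain ⟨k, hk⟩ := hG a (fun h0 => ha1 (h.apply_eq_zero_iff.2 h0)) _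
      (thirdTerm_le_secondTerm G hτ)
    -- Since [a, k] is in the third term, k centralizes a modulo it, and that centralizer is again
    -- A.
    have hkA : k ∈ CA := by
      have ha2 : πV a ∈ LinearMap.ker (Φ v₀).flip := by
        rw [← hA hv₀ hv₀']; exact (hAm a).1 ha
      rw [hAm, hA hv₀ hv₀', ← hb.ker_eq (hj v₀) hΦ₀ ha2 ha1, LinearMap.mem_ker, hbr, hk]
      exact h.homW.map_commutator_eq_zero hτ
    refine ⟨πA k, ?_⟩
    rw [hψ l hl a ha k hkA, hk]
    exact hwy

end IsLowerLayers

/-- A Camina `3`-group is of class at most three. -/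
theorem fourthTerm_eq_bot_of_three [Finite G] [Group.IsNilpotent G] (hG : HasFullCommutators G)
    (hp : ∀ x : G, x ^ 3 ∈ secondTerm G) : fourthTerm G = ⊥ := by
  by_contra hne
  have hne2 : secondTerm G ≠ ⊥ := by
    intro h
    apply hne
    rw [fourthTerm, thirdTerm, h, Subgroup.commutator_bot_left, Subgroup.commutator_bot_left]
  have hp3 := pow_mem_commutator_of_pow_mem _ (pow_mem_commutator_of_pow_mem _
    (pow_mem_commutator_of_pow_mem (⊤ : Subgroup G) fun c _ => hp c))
  obtain ⟨c₀, hc₀, hc₀'⟩ : ∃ c ∈ fourthTerm G, c ∉ ⁅fourthTerm G, (⊤ : Subgroup G)⁆ := by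
    by_contra! hc
    exact hne (eq_bot_of_le_commutator_top _ hc)
  obtain ⟨θ, hθ, hθ0⟩ := exists_invariantHom_ne_zero (p := 3) (fourthTerm G) hp3 hc₀ hc₀'
  obtain ⟨V, W, _, _, _, _, πV, πW, h⟩ := exists_isLowerLayers hp
  have := h.finite_left
  have := h.finite_right
  obtain ⟨br, hbr, halt, hsurj⟩ := h.exists_bracket (p := 3)
  have hb : IsCaminaBracket br :=
    isCaminaBracket_of_three (h.finrank_left_pos (secondTerm_ne_top hne2)) br halt (hsurj hG)
  obtain ⟨Φ, β, hΦ, hj, hβ, hs⟩ := h.exists_fourfoldBracket hθ hbr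
  have hΦ0 : Φ = 0 := IsFourfoldBracket.eq_zero (β := β)
    ⟨hj, hβ, hs, fun x v hx hv hv' =>
      h.two_mul_finrank_cokernelAt_le hG hθ hbr hb hΦ hj hx hv hv'⟩ hb (by decide)
  refine hθ0 (hθ.eq_zero_of_commutator (fun d hd v => ?_) hc₀)
  refine (hθ.commutator_left le_rfl v).eq_zero_of_commutator (fun w hw x => ?_) hd
  rw [← hΦ v w hw x, hΦ0]; rfl

end ClassThree

/-! ### The derived subgroup has exponent p. -/

section Exponents

universe u

variable {G : Type u} [Group G]

theorem commutatorElement_pow_three {a y : G} (hy : Commute ⁅y, ⁅a, y⁆⁆ y)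
    (hc : Commute ⁅y, ⁅a, y⁆⁆ ⁅a, y⁆) : ⁅a, y ^ 3⁆ = ⁅y, ⁅a, y⁆⁆ ^ 3 * ⁅a, y⁆ ^ 3 := by
  have e : ⁅a, y ^ 3⁆ = ⁅a, y⁆ * (y * (⁅a, y⁆ * (y * ⁅a, y⁆ * y⁻¹)) * y⁻¹) := by
    simp [commutatorElement_def, mul_assoc, pow_succ]
  generalize hcd : ⁅a, y⁆ = c at *
  have h1 : y * c * y⁻¹ = ⁅y, c⁆ * c := by simp [commutatorElement_def]
  generalize ⁅y, c⁆ = z at *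
  have h2 : y * (c * (z * c)) * y⁻¹ = (y * c * y⁻¹) * (y * z * y⁻¹) * (y * c * y⁻¹) := by
    simp [mul_assoc]
  have h3 : y * z * y⁻¹ = z := by rw [← hy.eq, mul_inv_cancel_right]
  rw [e, h1, h2, h1, h3]
  simp only [mul_assoc, hc.eq, hc.left_comm, pow_succ, pow_zero, one_mul]

/-- Pick θ on the third term with θ(g³) ≠ 0 and a outside G' with θ[G', a] = 0, which exists by
dimension. Writing g = [a, y], the identity [a, y³] = [y, g]³ g³ gives θ(g³) = 0, because y³ ∈ G'
and 3 = 0. -/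
theorem pow_three_eq_one_of_mem_secondTerm [Finite G] [Group.IsNilpotent G]
    (hG : HasFullCommutators G) (hp : ∀ x : G, x ^ 3 ∈ secondTerm G) {g : G}
    (hg : g ∈ secondTerm G) : g ^ 3 = 1 := by
  by_contra hg3
  have h4 := fourthTerm_eq_bot_of_three hG hp
  have hne2 : secondTerm G ≠ ⊥ := fun h => hg3 (by
    rw [h, Subgroup.mem_bot] at hg
    rw [hg, one_pow])
  have hp2 := pow_mem_commutator_of_pow_mem (⊤ : Subgroup G) fun c _ => hp c
  have hcomm : ∀ z ∈ thirdTerm G, ∀ y, Commute z y := fun z hz y => by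
    have := commutator_mem_fourthTerm hz y
    rw [h4, Subgroup.mem_bot] at this
    exact commutatorElement_eq_one_iff_mul_comm.1 this
  obtain ⟨θ, hθ, hθ0⟩ := exists_invariantHom_ne_zero (p := 3) (thirdTerm G)
    (pow_mem_commutator_of_pow_mem _ hp2) (hp2 g hg)
    (fun h => hg3 (by rwa [← Subgroup.mem_bot, ← h4]))
  obtain ⟨V, W, _, _, _, _, πV, πW, h⟩ := exists_isLowerLayers hp
  have := h.finite_left
  have := h.finite_right
  obtain ⟨br, hbr, halt, hsurj⟩ := h.exists_bracket (p := 3)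
  have hV := h.finrank_left_pos (p := 3) (secondTerm_ne_top hne2)
  have hb : IsCaminaBracket br := isCaminaBracket_of_three hV br halt (hsurj hG)
  obtain ⟨f, hf, -⟩ := h.exists_tripleBracket hθ
  obtain ⟨v, hv, hv0⟩ : ∃ v ∈ LinearMap.ker f.flip, v ≠ 0 := by
    apply IsFourfoldBracket.exists_mem_ne_zero_of_finrank_pos
    have h2 := LinearMap.finrank_range_add_finrank_ker f.flip
    have h3 := Submodule.finrank_le (LinearMap.range f.flip)
    rw [Subspace.dual_finrank_eq] at h3
    have := hb.two_mul_finrank_le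
    omega
  obtain ⟨a, -, rfl⟩ := h.surjV v
  obtain ⟨y, rfl⟩ := hG a (fun ha => hv0 (h.apply_eq_zero_iff.2 ha)) g hg
  have hz := commutator_mem_thirdTerm_right y hg
  apply hθ0
  have e := congrArg θ (commutatorElement_pow_three (hcomm _ hz y) (hcomm _ hz _))
  have hay : ⁅y ^ 3, a⁆ ∈ thirdTerm G := commutator_mem_thirdTerm (hp y) a
  have h0 : θ ⁅y ^ 3, a⁆ = 0 := by
    rw [← hf _ (hp y)]
    exact LinearMap.congr_fun (LinearMap.mem_ker.1 hv) _
  rw [hθ.commutator_swap hay, h0, hθ.map_mul _ (Subgroup.pow_mem _ hz 3) _ (hp2 _ hg),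
    hθ.map_pow hz, neg_zero, nsmul_eq_mul, show ((3 : ℕ) : ZMod 3) = 0 from rfl, zero_mul,
    zero_add] at e
  exact e.symm

/-- A Camina `p`-group with `p = 2` or `p = 3` has derived subgroup of exponent `p`. -/
theorem HasFullCommutators.pow_eq_one_of_mem_secondTerm [Finite G] [Group.IsNilpotent G]
    (hG : HasFullCommutators G) {p : ℕ} (hp : p = 2 ∨ p = 3) (hx : ∀ x : G, x ^ p ∈ secondTerm G)
    {g : G} (hg : g ∈ secondTerm G) : g ^ p = 1 := by
  obtain rfl | rfl := hp
  · have := pow_mem_commutator_of_pow_mem (⊤ : Subgroup G) (fun c _ => hx c) g hg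
    rwa [← thirdTerm, thirdTerm_eq_bot_of_two hG hx, Subgroup.mem_bot] at this
  · exact pow_three_eq_one_of_mem_secondTerm hG hx hg

end Exponents

/-! ### The involution of the integral group ring. -/

section GroupRing

namespace MonoidAlgebra

variable {G : Type*} [Group G]

/-- The anti-automorphism `g ↦ g⁻¹` of the integral group ring, as a map to the opposite ring. -/
noncomputable def invOp (G : Type*) [Group G] :
    MonoidAlgebra ℤ G →ₐ[ℤ] (MonoidAlgebra ℤ G)ᵐᵒᵖ :=
  MonoidAlgebra.lift ℤ (MonoidAlgebra ℤ G)ᵐᵒᵖ G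
    { toFun := fun g => MulOpposite.op (MonoidAlgebra.single g⁻¹ 1)
      map_one' := by simp [MonoidAlgebra.one_def]
      map_mul' := fun g h => by
        rw [← MulOpposite.op_mul, MonoidAlgebra.single_mul_single, mul_inv_rev, one_mul] }

/-- The anti-automorphism `g ↦ g⁻¹` of the integral group ring. -/
noncomputable def invert (x : MonoidAlgebra ℤ G) : MonoidAlgebra ℤ G :=
  MulOpposite.unop (invOp G x)

theorem invert_add (x y : MonoidAlgebra ℤ G) : invert (x + y) = invert x + invert y := by
  simp [invert]

theorem invert_zero : invert (0 : MonoidAlgebra ℤ G) = 0 := by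
  simp [invert]

theorem invert_mul (x y : MonoidAlgebra ℤ G) : invert (x * y) = invert y * invert x := by
  simp [invert]

theorem invert_one : invert (1 : MonoidAlgebra ℤ G) = 1 := by
  simp [invert]

theorem invert_single (g : G) (a : ℤ) : invert (single g a) = single g⁻¹ a := by
  rw [invert, invOp, lift_single]
  change a • (single g⁻¹ (1 : ℤ)) = _
  rw [smul_single, smul_eq_mul, mul_one]

theorem invert_invert (x : MonoidAlgebra ℤ G) : invert (invert x) = x := by
  induction x using MonoidAlgebra.induction_linear with
  | zero => rw [invert_zero, invert_zero]
  | add x y hx hy => rw [invert_add, invert_add, hx, hy]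
  | single g a => rw [invert_single, invert_single, inv_inv]

theorem coeff_invert (x : MonoidAlgebra ℤ G) (g : G) : (invert x).coeff g = x.coeff g⁻¹ := by
  classical
  induction x using MonoidAlgebra.induction_linear with
  | zero => rw [invert_zero]; rfl
  | add x y hx hy =>
    rw [invert_add, coeff_add, coeff_add, Finsupp.add_apply, Finsupp.add_apply, hx, hy]
  | single h a =>
    rw [invert_single, coeff_single, coeff_single, Finsupp.single_apply, Finsupp.single_apply]
    simp only [inv_eq_iff_eq_inv]

theorem coeff_mul_invert_one [Fintype G] (x : MonoidAlgebra ℤ G) :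
    (x * invert x).coeff 1 = ∑ g, x.coeff g ^ 2 := by
  rw [coeff_mul_apply_left, Finsupp.sum_fintype _ _ (by simp)]
  refine Finset.sum_congr rfl fun g _ => ?_
  rw [coeff_invert, mul_one, inv_inv, pow_two]

/-- A unit `u` with `(u u*)² = 1` is up to sign an element of the group. -/
theorem eq_single_of_sq_mul_invert_eq_one [Finite G] {u : MonoidAlgebra ℤ G}
    (h : (u * invert u) * (u * invert u) = 1) :
    ∃ g, u = single g 1 ∨ u = -single g 1 := by
  classical
  have := Fintype.ofFinite G
  have hv : invert (u * invert u) = u * invert u := by rw [invert_mul, invert_invert]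
  -- The element v = uu* is self-adjoint with v² = 1, so its squared coefficients sum to 1. Its
  -- coefficient at 1, which is the sum of the squared coefficients of u, is therefore at most 1.
  have h1 : ∑ g, (u * invert u).coeff g ^ 2 = 1 := by
    rw [← coeff_mul_invert_one, hv, h, one_def, coeff_single, Finsupp.single_eq_same]
  have h2 : (u * invert u).coeff 1 ^ 2 ≤ 1 := by
    rw [← h1]
    exact Finset.single_le_sum (f := fun g => (u * invert u).coeff g ^ 2)
      (fun g _ => sq_nonneg _) (Finset.mem_univ 1)
  have h3 : ∑ g, u.coeff g ^ 2 ≤ 1 := by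
    rw [← coeff_mul_invert_one]
    nlinarith
  obtain ⟨g, hg⟩ : ∃ g, u.coeff g ≠ 0 := by
    by_contra! hc
    have : u = 0 := by ext g; exact hc g
    rw [this, zero_mul, zero_mul] at h
    exact zero_ne_one h
  have h4 := Finset.add_sum_erase Finset.univ (fun g => u.coeff g ^ 2) (Finset.mem_univ g)
  have h5 : 1 ≤ u.coeff g ^ 2 := Int.add_one_le_iff.2 (sq_pos_of_ne_zero hg)
  have h6 : ∑ k ∈ Finset.univ.erase g, u.coeff k ^ 2 = 0 :=
    le_antisymm (by linarith) (Finset.sum_nonneg fun k _ => sq_nonneg _)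
  have h7 : ∀ k, k ≠ g → u.coeff k = 0 := fun k hk => by
    have := (Finset.sum_eq_zero_iff_of_nonneg (fun k _ => sq_nonneg _)).1 h6 k
      (Finset.mem_erase.2 ⟨hk, Finset.mem_univ k⟩)
    exact pow_eq_zero_iff two_ne_zero |>.1 this
  have h8 : u = single g (u.coeff g) := by
    ext k
    rw [coeff_single, Finsupp.single_apply]
    split_ifs with hk
    · rw [hk]
    · exact h7 k (Ne.symm hk)
  have h9 : u.coeff g ^ 2 = 1 := by
    simp only [h6, add_zero] at h4
    exact le_antisymm (h4 ▸ h3) h5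
  refine ⟨g, ?_⟩
  rcases mul_self_eq_one_iff.1 ((pow_two _).symm.trans h9) with e | e
  · left; rw [h8, e]
  · right; rw [h8, e]; simp

end MonoidAlgebra

end GroupRing

/-! ### Galois action on traces of operators of finite order. -/

section Traces

variable {k S : Type*} [Field k] [IsAlgClosed k] [CharZero k] [AddCommGroup S] [Module k S]
  [FiniteDimensional k S]

/-- The polynomial X^n - 1 is separable in characteristic zero, so f is diagonalizable; `m` records
eigenvalue multiplicities, independent of j. -/
theorem Module.End.exists_trace_pow_eq_sum {n : ℕ} (hn : n ≠ 0) (f : Module.End k S)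
    (hf : f ^ n = 1) : ∃ (s : Finset k) (m : k → ℕ), (∀ c ∈ s, c ^ n = 1) ∧
      ∀ j, LinearMap.trace k S (f ^ j) = ∑ c ∈ s, (m c : k) * c ^ j := by
  classical
  have hss : f.IsSemisimple := by
    refine Module.End.isSemisimple_of_squarefree_aeval_eq_zero
      (p := (Polynomial.X ^ n - 1 : Polynomial k)) ?_ (by simp [hf])
    exact (Polynomial.separable_X_pow_sub_C (1 : k) (by exact_mod_cast hn) one_ne_zero).squarefree
  have htop : ⨆ c, f.eigenspace c = ⊤ := by
    rw [← f.iSup_maxGenEigenspace_eq_top]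
    congr 1
    ext1 c
    exact (hss.isFinitelySemisimple.maxGenEigenspace_eq_eigenspace c).symm
  have hint : DirectSum.IsInternal f.eigenspace :=
    DirectSum.isInternal_submodule_of_iSupIndep_of_iSup_eq_top f.eigenspaces_iSupIndep htop
  have hpow : ∀ j c, ∀ x ∈ f.eigenspace c, (f ^ j) x = c ^ j • x := by
    intro j c x hx
    induction j with
    | zero => simp
    | succ j ih =>
      rw [pow_succ', Module.End.mul_apply, ih, map_smul, Module.End.mem_eigenspace_iff.1 hx,
        smul_smul, pow_succ]
  have hmaps : ∀ j c, Set.MapsTo (⇑(f ^ j)) (f.eigenspace c : Set S)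
      (f.eigenspace c : Set S) := fun j c x hx => by
    rw [SetLike.mem_coe, hpow j c x hx]
    exact Submodule.smul_mem _ _ hx
  have hfin : {c | f.eigenspace c ≠ ⊥}.Finite :=
    WellFoundedGT.finite_ne_bot_of_iSupIndep f.eigenspaces_iSupIndep
  refine ⟨hfin.toFinset, fun c => finrank k (f.eigenspace c), fun c hc => ?_, fun j => ?_⟩
  · rw [Set.Finite.mem_toFinset] at hc
    obtain ⟨x, hx, hx0⟩ := Submodule.exists_mem_ne_zero_of_ne_bot hc
    have := hpow n c x hx
    rw [hf, Module.End.one_apply] at this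
    have h2 : (c ^ n - 1) • x = 0 := by rw [sub_smul, one_smul, ← this, sub_self]
    exact sub_eq_zero.1 ((smul_eq_zero.1 h2).resolve_right hx0)
  · rw [LinearMap.trace_eq_sum_trace_restrict' hint hfin (hmaps j)]
    refine Finset.sum_congr rfl fun c _ => ?_
    have e : (f ^ j).restrict (hmaps j c) = c ^ j • LinearMap.id := by
      ext x
      exact hpow j c x x.2
    rw [e, map_smul, LinearMap.trace_id, smul_eq_mul, mul_comm]

theorem RingEquiv.exists_coprime_pow {n : ℕ} (hn : n ≠ 0) (σ : k ≃+* k) :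
    ∃ j, j.Coprime n ∧ ∀ c : k, c ^ n = 1 → σ c = c ^ j := by
  have : NeZero n := ⟨hn⟩
  obtain ⟨ζ, hζ⟩ := HasEnoughRootsOfUnity.exists_primitiveRoot k n
  have hσ : IsPrimitiveRoot (σ ζ) n := hζ.map_of_injective σ.injective
  obtain ⟨j, -, hj⟩ := hζ.eq_pow_of_pow_eq_one hσ.pow_eq_one
  refine ⟨j, (hζ.pow_iff_coprime (Nat.pos_of_ne_zero hn) j).1 (hj ▸ hσ), fun c hc => ?_⟩
  obtain ⟨i, -, rfl⟩ := hζ.eq_pow_of_pow_eq_one hc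
  rw [map_pow, ← hj, ← pow_mul, ← pow_mul, mul_comm]

/-- An automorphism raises all n-th roots of unity to one common power j, which therefore works for
every f at once. -/
theorem RingEquiv.exists_map_trace_eq {n : ℕ} (hn : n ≠ 0) (σ : k ≃+* k) :
    ∃ j, j.Coprime n ∧ ∀ f : Module.End k S, f ^ n = 1 →
      σ (LinearMap.trace k S f) = LinearMap.trace k S (f ^ j) := by
  obtain ⟨j, hj, hσ⟩ := σ.exists_coprime_pow hn
  refine ⟨j, hj, fun f hf => ?_⟩
  obtain ⟨s, m, hs, ht⟩ := f.exists_trace_pow_eq_sum hn hf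
  have h1 := ht 1
  rw [pow_one] at h1
  rw [h1, ht, map_sum]
  refine Finset.sum_congr rfl fun c hc => ?_
  rw [map_mul, map_natCast, pow_one, hσ c (hs c hc)]

end Traces

/-! ### Central units under a condition on power maps. -/

section CentralUnits

namespace MonoidAlgebra

variable {G : Type*} [Group G]

theorem mul_comm_of_forall_single {R : Type*} [CommRing R] {a : MonoidAlgebra R G}
    (h : ∀ g : G, a * single g 1 = single g 1 * a) (b : MonoidAlgebra R G) : a * b = b * a := by
  induction b using MonoidAlgebra.induction_linear with
  | zero => rw [mul_zero, zero_mul]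
  | add x y hx hy => rw [mul_add, add_mul, hx, hy]
  | single g r =>
    have e : (single g r : MonoidAlgebra R G) = r • single g 1 := by
      rw [smul_single, smul_eq_mul, mul_one]
    rw [e, mul_smul_comm, smul_mul_assoc, h]

theorem _root_.IsSimpleModule.exists_forall_smul_eq {k : Type*} [Field k] [IsAlgClosed k]
    {A S : Type*} [Ring A] [Algebra k A]
    [AddCommGroup S] [Module k S] [Module A S] [IsScalarTower k A S] [IsSimpleModule A S]
    [FiniteDimensional k S] {a : A} (ha : ∀ b, a * b = b * a) :
    ∃ c : k, ∀ s : S, a • s = c • s := by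
  let φ : Module.End A S :=
    { toFun := fun s => a • s
      map_add' := smul_add a
      map_smul' := fun b s => by rw [RingHom.id_apply, smul_smul, smul_smul, ha] }
  obtain ⟨c, hc⟩ := (IsSimpleModule.algebraMap_end_bijective_of_isAlgClosed k).2 φ
  exact ⟨c, fun s => (LinearMap.congr_fun hc s).symm⟩

section Scalar

variable {k S : Type*} [Field k] [IsAlgClosed k] [CharZero k] [AddCommGroup S] [Module k S]
  [FiniteDimensional k S]

/-- Galois automorphisms act on traces by powers of group elements. -/
theorem map_trace_eq [Finite G] (ρ : MonoidAlgebra ℤ G →+* Module.End k S)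
    (h : ∀ j, j.Coprime (Nat.card G) →
      (∀ g : G, IsConj g (g ^ j)) ∨ ∀ g : G, IsConj g⁻¹ (g ^ j)) (σ : k ≃+* k) :
    (∀ x, σ (LinearMap.trace k S (ρ x)) = LinearMap.trace k S (ρ x)) ∨
      ∀ x, σ (LinearMap.trace k S (ρ x)) = LinearMap.trace k S (ρ (invert x)) := by
  obtain ⟨j, hj, hσ⟩ := σ.exists_map_trace_eq (S := S) (Nat.card_pos (α := G)).ne'
  have hσ' : ∀ g : G, σ (LinearMap.trace k S (ρ (single g 1))) =
      LinearMap.trace k S (ρ (single (g ^ j) 1)) := by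
    intro g
    rw [hσ, ← map_pow, single_pow, one_pow]
    rw [← map_pow, single_pow, one_pow, pow_card_eq_one', ← one_def, map_one]
  have hconj : ∀ g g' : G, IsConj g g' → LinearMap.trace k S (ρ (single g 1)) =
      LinearMap.trace k S (ρ (single g' 1)) := by
    intro g g' hg
    obtain ⟨c, rfl⟩ := isConj_iff.1 hg
    have e : (single (c * g * c⁻¹) 1 : MonoidAlgebra ℤ G) =
        single c 1 * single g 1 * single c⁻¹ 1 := by
      rw [single_mul_single, single_mul_single, one_mul, one_mul]
    rw [e, map_mul, LinearMap.trace_mul_comm, ← map_mul, ← mul_assoc, single_mul_single,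
      inv_mul_cancel, one_mul, ← one_def, one_mul]
  have hsingle : ∀ (g : G) (a : ℤ), LinearMap.trace k S (ρ (single g a)) =
      a • LinearMap.trace k S (ρ (single g 1)) := by
    intro g a
    rw [← map_zsmul, ← map_zsmul, smul_single, smul_eq_mul, mul_one]
  refine (h j hj).imp (fun h x => ?_) (fun h x => ?_)
  · induction x using MonoidAlgebra.induction_linear with
    | zero => simp
    | add x y hx hy => rw [map_add, map_add, map_add, hx, hy]
    | single g a => rw [hsingle, map_zsmul, hσ', hconj _ _ (h g)]
  · induction x using MonoidAlgebra.induction_linear with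
    | zero => rw [invert_zero, map_zero, map_zero, map_zero]
    | add x y hx hy => rw [invert_add, map_add, map_add, map_add, map_add, map_add, hx, hy]
    | single g a => rw [invert_single, hsingle g a, hsingle g⁻¹ a, map_zsmul, hσ', hconj _ _ (h g)]

/-- Traces are the scalars times the dimension, so σ either fixes c and c' or exchanges them; the
product is fixed both ways. -/
theorem map_scalar_mul_eq [Finite G] [Nontrivial S] (ρ : MonoidAlgebra ℤ G →+* Module.End k S)
    (h : ∀ j, j.Coprime (Nat.card G) →
      (∀ g : G, IsConj g (g ^ j)) ∨ ∀ g : G, IsConj g⁻¹ (g ^ j)) (σ : k ≃+* k)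
    {u : MonoidAlgebra ℤ G} {c c' : k} (hc : ρ u = c • 1) (hc' : ρ (invert u) = c' • 1) :
    σ (c * c') = c * c' := by
  have hd : (finrank k S : k) ≠ 0 := by exact_mod_cast finrank_pos.ne'
  have ht : ∀ {x : MonoidAlgebra ℤ G} {b : k}, ρ x = b • 1 →
      LinearMap.trace k S (ρ x) = b * finrank k S := by
    intro x b hb
    rw [hb, map_smul, LinearMap.trace_one, smul_eq_mul]
  rcases map_trace_eq ρ h σ with hσ | hσ
  · have h1 := hσ u
    have h2 := hσ (invert u)
    rw [ht hc, map_mul, map_natCast] at h1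
    rw [ht hc', map_mul, map_natCast] at h2
    rw [map_mul, mul_right_cancel₀ hd h1, mul_right_cancel₀ hd h2]
  · have h1 := hσ u
    have h2 := hσ (invert u)
    rw [ht hc, ht hc', map_mul, map_natCast] at h1
    rw [invert_invert, ht hc, ht hc', map_mul, map_natCast] at h2
    rw [map_mul, mul_right_cancel₀ hd h1, mul_right_cancel₀ hd h2, mul_comm]

theorem isIntegral_scalar [Finite G] [Nontrivial S] (ρ : MonoidAlgebra ℤ G →+* Module.End k S)
    {x : MonoidAlgebra ℤ G} {c : k} (hc : ρ x = c • 1) : IsIntegral ℤ c := by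
  have h1 : IsIntegral ℤ x := Algebra.IsIntegral.isIntegral x
  have h2 := h1.map ρ.toIntAlgHom
  have e : ρ.toIntAlgHom x = algebraMap k (Module.End k S) c := by
    rw [Algebra.algebraMap_eq_smul_one]; exact hc
  rw [e] at h2
  exact (isIntegral_algebraMap_iff (FaithfulSMul.algebraMap_injective k (Module.End k S))).1 h2

end Scalar

theorem _root_.IsIntegral.exists_int_of_fixed {k : Type*} [Field k] [Algebra ℚ k] [IsGalois ℚ k]
    {c : k} (hc : IsIntegral ℤ c) (hσ : ∀ σ : k ≃+* k, σ c = c) : ∃ z : ℤ, c = z := by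
  obtain ⟨q, rfl⟩ := (InfiniteGalois.mem_range_algebraMap_iff_fixed (k := ℚ) c).2
    fun f => hσ f.toRingEquiv
  have hq : IsIntegral ℤ q :=
    (isIntegral_algebraMap_iff (algebraMap ℚ k).injective).1 hc
  obtain ⟨z, rfl⟩ := IsIntegrallyClosed.isIntegral_iff.1 hq
  exact ⟨z, by simp⟩

/-- Algebraic closedness serves Schur's lemma; being Galois over ℚ makes elements fixed by all
automorphisms rational. -/
theorem _root_.exists_isAlgClosed_isGalois_rat : ∃ (k : Type) (_ : Field k) (_ : IsAlgClosed k)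
    (_ : CharZero k) (_ : Algebra ℚ k), IsGalois ℚ k := by
  let alg : Algebra ℚ (AlgebraicClosure ℚ) := AlgebraicClosure.instAlgebra ℚ
  have : @IsAlgClosure ℚ (AlgebraicClosure ℚ) _ _ alg _ := AlgebraicClosure.instIsAlgClosure ℚ
  exact ⟨AlgebraicClosure ℚ, inferInstance, inferInstance, inferInstance, alg,
    @IsAlgClosure.isGalois ℚ (AlgebraicClosure ℚ) _ _ alg this _⟩

/-- An element of a semisimple ring which annihilates all simple modules is zero. -/
theorem _root_.IsSemisimpleRing.eq_zero_of_forall_smul_eq_zero {A : Type*} [Ring A]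
    [IsSemisimpleRing A] {a : A}
    (h : ∀ I : Ideal A, I.IsMaximal → ∀ s : A ⧸ I, a • s = 0) : a = 0 := by
  have h1 : a ∈ Ring.jacobson A := by
    rw [Ring.jacobson_eq_sInf_isMaximal, Submodule.mem_sInf]
    intro I hI
    have h2 := h I hI (Submodule.Quotient.mk 1)
    rw [← Submodule.Quotient.mk_smul, smul_eq_mul, mul_one] at h2
    exact (Submodule.Quotient.mk_eq_zero I).1 h2
  rwa [Ring.jacobson, IsSemisimpleModule.jacobson_eq_bot, Submodule.mem_bot] at h1

end MonoidAlgebra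

open MonoidAlgebra in
/-- A finite group in which, for every `j` coprime to the order, raising to the power `j` induces
the identity or the inversion on conjugacy classes, has the cut-property. -/
theorem hasCutProperty_of_isConj_pow {G : Type*} [Group G] [Finite G]
    (h : ∀ j, j.Coprime (Nat.card G) →
      (∀ g : G, IsConj g (g ^ j)) ∨ ∀ g : G, IsConj g⁻¹ (g ^ j)) : HasCutProperty G := by
  intro u hu
  have hsu : ∀ g : G, (u : MonoidAlgebra ℤ G) * single g 1 =
      single g 1 * (u : MonoidAlgebra ℤ G) := by
    intro g
    let v : (MonoidAlgebra ℤ G)ˣ :=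
      ⟨single g 1, single g⁻¹ 1, by simp [single_mul_single, one_def],
        by simp [single_mul_single, one_def]⟩
    exact congrArg Units.val (Subgroup.mem_center_iff.1 hu v).symm
  have hsi : ∀ g : G, invert (u : MonoidAlgebra ℤ G) * single g 1 =
      single g 1 * invert (u : MonoidAlgebra ℤ G) := by
    intro g
    have := congrArg invert (hsu g⁻¹)
    rw [invert_mul, invert_mul, invert_single, inv_inv] at this
    exact this.symm
  have hcomm := mul_comm_of_forall_single hsu
  set v : MonoidAlgebra ℤ G := u * invert (u : MonoidAlgebra ℤ G) with hv
  set w : MonoidAlgebra ℤ G := ↑u⁻¹ * invert (↑u⁻¹ : MonoidAlgebra ℤ G) with hw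
  have hvw : v * w = 1 := by
    have h1 : invert (u : MonoidAlgebra ℤ G) * invert (↑u⁻¹ : MonoidAlgebra ℤ G) = 1 := by
      rw [← invert_mul, Units.inv_mul, invert_one]
    rw [hv, hcomm, hw, mul_assoc, ← mul_assoc (u : MonoidAlgebra ℤ G), Units.mul_inv, one_mul, h1]
  obtain ⟨k, _, _, _, _, _⟩ := exists_isAlgClosed_isGalois_rat
  let A := MonoidAlgebra k G
  let i : MonoidAlgebra ℤ G →+* A := mapRingHom G (Int.castRingHom k)
  have hi : Function.Injective i := map_injective _ (RingHom.injective_int (Int.castRingHom k))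
  have hic : ∀ {x : MonoidAlgebra ℤ G}, (∀ g : G, x * single g 1 = single g 1 * x) →
      ∀ b, i x * b = b * i x := by
    intro x hx
    apply mul_comm_of_forall_single
    intro g
    have := congrArg i (hx g)
    rwa [map_mul, map_mul, mapRingHom_single, map_one] at this
  have hvv : v * v = 1 := by
    apply hi
    rw [← sub_eq_zero]
    apply IsSemisimpleRing.eq_zero_of_forall_smul_eq_zero
    intro I hI s
    have : IsSimpleModule A (A ⧸ I) := isSimpleModule_iff_isCoatom.2 hI.out
    have : Nontrivial (A ⧸ I) := IsSimpleModule.nontrivial A _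
    have : FiniteDimensional k A := inferInstance
    have : FiniteDimensional k (A ⧸ I) := inferInstance
    let ρ : MonoidAlgebra ℤ G →+* Module.End k (A ⧸ I) :=
      (Algebra.lsmul k k (A ⧸ I) : A →ₐ[k] Module.End k (A ⧸ I)).toRingHom.comp i
    have hρ : ∀ x s, ρ x s = i x • s := fun x s => rfl
    obtain ⟨c, hc⟩ := IsSimpleModule.exists_forall_smul_eq (k := k) (S := A ⧸ I) (hic hsu)
    obtain ⟨c', hc'⟩ := IsSimpleModule.exists_forall_smul_eq (k := k) (S := A ⧸ I) (hic hsi)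
    have hc1 : ρ u = c • 1 := LinearMap.ext hc
    have hc1' : ρ (invert (u : MonoidAlgebra ℤ G)) = c' • 1 := LinearMap.ext hc'
    have hσ := fun σ => map_scalar_mul_eq ρ h σ hc1 hc1'
    have hN : ρ v = (c * c') • 1 := by
      rw [hv, map_mul, hc1, hc1', smul_mul_smul_comm, one_mul]
    have hN0 : c * c' ≠ 0 := by
      intro h0
      have := congrArg ρ hvw
      rw [map_mul, hN, h0, zero_smul, zero_mul, map_one] at this
      exact zero_ne_one this
    have hM : ρ w = (c * c')⁻¹ • 1 := by
      have := congrArg ρ hvw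
      rw [map_mul, hN, map_one, smul_mul_assoc, one_mul] at this
      rw [← this, smul_smul, inv_mul_cancel₀ hN0, one_smul]
    -- Both the scalar of v and its inverse, the scalar of w, are integers, hence ±1.
    obtain ⟨z, hz⟩ := IsIntegral.exists_int_of_fixed (isIntegral_scalar ρ hN) hσ
    obtain ⟨z', hz'⟩ := IsIntegral.exists_int_of_fixed (isIntegral_scalar ρ hM)
      fun σ => by rw [map_inv₀, hσ]
    have hzz : z * z' = 1 := by
      have := mul_inv_cancel₀ hN0
      rw [hz', hz] at this
      exact_mod_cast this
    have hz2 : z * z = 1 := by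
      rcases Int.eq_one_or_neg_one_of_mul_eq_one hzz with e | e <;> rw [e] <;> rfl
    have hfin : ρ (v * v) = 1 := by
      rw [map_mul, hN, smul_mul_smul_comm, one_mul, hz, ← Int.cast_mul, hz2, Int.cast_one, one_smul]
    rw [map_one, sub_smul, one_smul, ← hρ, hfin, Module.End.one_apply, sub_self]
  obtain ⟨g, hg⟩ := eq_single_of_sq_mul_invert_eq_one hvv
  refine ⟨g, Subgroup.mem_center_iff.2 fun x => ?_, hg⟩
  have hx := hsu x
  have hsg : (single g 1 : MonoidAlgebra ℤ G) * single x 1 = single x 1 * single g 1 := by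
    rcases hg with hg | hg
    · rwa [hg] at hx
    · rw [hg, neg_mul, mul_neg, neg_inj] at hx
      exact hx
  rw [single_mul_single, single_mul_single] at hsg
  have := (of_injective (R := ℤ) hsg)
  exact this.symm

end CentralUnits

/-! ### Power maps on classes of Camina groups. -/

section CaminaCut

variable {G : Type*} [Group G]

theorem IsCaminaGroup.isConj_of_inv_mul_mem (hG : IsCaminaGroup G) {g h : G}
    (hg : g ∉ commutator G) (hgh : g⁻¹ * h ∈ commutator G) : IsConj g h := by
  change h ∈ conjugatesOf g
  rw [← hG.2 g hg]
  exact ⟨_, hgh, mul_inv_cancel_left g h⟩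

/-- As p ≤ 3, j is 1 + pq or pq - 1, so g^j is g or g⁻¹ times a power of g^p. That factor is trivial
for g in G', and otherwise stays inside the coset, which is a class. -/
theorem IsCaminaGroup.isConj_pow_or [Finite G] (hG : IsCaminaGroup G) {p : ℕ}
    (hp : p = 2 ∨ p = 3) (hx : ∀ x : G, x ^ p ∈ commutator G)
    (hd : ∀ g ∈ commutator G, g ^ p = 1) {j : ℕ} (hj : j.Coprime p) :
    (∀ g : G, IsConj g (g ^ j)) ∨ ∀ g : G, IsConj g⁻¹ (g ^ j) := by
  have key : ∀ (a g : G) (q : ℕ), (a ∈ commutator G ↔ g ∈ commutator G) →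
      IsConj a (a * (g ^ p) ^ q) := by
    intro a g q hag
    by_cases hg : g ∈ commutator G
    · rw [hd g hg, one_pow, mul_one]
    · refine hG.isConj_of_inv_mul_mem (fun ha => hg (hag.1 ha)) ?_
      rw [inv_mul_cancel_left]
      exact Subgroup.pow_mem _ (hx g) q
  have hmod : (∃ q, j = 1 + p * q) ∨ ∃ q, j + 1 = p * q := by
    obtain rfl | rfl := hp
    · have : ¬ 2 ∣ j := fun h => by
        have := Nat.eq_one_of_dvd_coprimes hj h dvd_rfl
        omega
      exact Or.inl ⟨j / 2, by omega⟩
    · have : ¬ 3 ∣ j := fun h => by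
        have := Nat.eq_one_of_dvd_coprimes hj h dvd_rfl
        omega
      rcases Nat.lt_or_ge (j % 3) 2 with h | h
      · exact Or.inl ⟨j / 3, by omega⟩
      · exact Or.inr ⟨j / 3 + 1, by omega⟩
  refine hmod.imp ?_ ?_
  · rintro ⟨q, rfl⟩ g
    rw [pow_add, pow_one, pow_mul]
    exact key g g q Iff.rfl
  · rintro ⟨q, hq⟩ g
    have e : g ^ j = g⁻¹ * (g ^ p) ^ q := by
      rw [← pow_mul, ← hq, pow_succ', inv_mul_cancel_left]
    rw [e]
    exact key g⁻¹ g q inv_mem_iff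

end CaminaCut

theorem theorem2p6 (p : ℕ) (hp : p = 2 ∨ p = 3) (G : Type*) [Group G] [Finite G]
    (hpG : IsPGroup p G) (hna : ¬ ∀ a b : G, a * b = b * a) (hG : IsCaminaGroup G) :
    HasCutProperty G := by
  have hprime : Fact p.Prime := by
    obtain rfl | rfl := hp
    · exact ⟨Nat.prime_two⟩
    · exact ⟨Nat.prime_three⟩
  have hnil : Group.IsNilpotent G := hpG.isNilpotent
  obtain ⟨n, hn⟩ := hpG.exists_card_eq
  have hne : secondTerm G ≠ ⊥ := fun h => hna fun a b => by
    have := commutator_mem_secondTerm a b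
    rw [h, Subgroup.mem_bot] at this
    exact commutatorElement_eq_one_iff_mul_comm.1 this
  have hfull := hG.hasFullCommutators
  have hx : ∀ x : G, x ^ p ∈ secondTerm G :=
    hfull.pow_mem ⟨n, fun g => by rw [← hn, pow_card_eq_one']⟩ hne
  have hn0 : n ≠ 0 := by
    rintro rfl
    rw [pow_zero, Nat.card_eq_one_iff_unique] at hn
    have := hn.1
    exact hna fun a b => Subsingleton.elim _ _
  refine hasCutProperty_of_isConj_pow fun j hj => hG.isConj_pow_or hp hx
    (fun g hg => hfull.pow_eq_one_of_mem_secondTerm hp hx hg) ?_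
  rw [hn] at hj
  exact (Nat.coprime_pow_right_iff (Nat.pos_of_ne_zero hn0) _ _).1 hj
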